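/- Let $d\ge 1$ and, for $-d<b<a$, let $W_{a,b}(x)=\frac{|x|^a}{a}-\frac{|x|^b}{b}$ on $\mathbb{R}^d$, where $\frac{|x|^0}{0}$ is understood as $\ln|x|$ and $W_{a,b}(0)=+\infty$ if $b\le 0$. For a Borel probability measure $\rho$ on $\mathbb{R}^d$ let $$E_{a,b}[\rho]=\frac12\int_{\mathbb{R}^d}\int_{\mathbb{R}^d}W_{a,b}(x-y)\,\mathrm{d}\rho(y)\,\mathrm{d}\rho(x)\in\mathbb{R}\cup\{\infty\}.$$ For every $-d<b<2$ there exists $a_-(b)<2$ such that, for every $a>b$ with $a_-(b)<a<2$, the energy $E_{a,b}$ has a minimizer among all Borel probability measures on $\mathbb{R}^d$, and this minimizer is unique up to translation. -/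

import Mathlib

open MeasureTheory

/-- The function `r ↦ r ^ c / c` of `r > 0`, with the convention that it means `log r` for
`c = 0`. -/
noncomputable def powerTerm (c r : ℝ) : ℝ :=
  if c = 0 then Real.log r else r ^ c / c

/-- The power-law potential `W_{a,b}(x) = |x|^a / a - |x|^b / b` on `ℝ^d` (with `|x|^0 / 0 = log |x|`),
for `b < a`, with values in `ℝ ∪ {∞}`. For `b ≤ 0` it is singular at the origin, and there it takes
its limit value `∞`. -/
noncomputable def powerLawPotential (d : ℕ) (a b : ℝ) (x : EuclideanSpace ℝ (Fin d)) : EReal :=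
  if x = 0 ∧ b ≤ 0 then ⊤ else ((powerTerm a ‖x‖ - powerTerm b ‖x‖ : ℝ) : EReal)

/-- The interaction energy `E[ρ] = (1/2) ∫ ∫ W (x - y) dρ(y) dρ(x)` of a measure `ρ`. The double
integral is that of the positive part of `W` minus that of its negative part. The latter is finite
if `W` is bounded from below and `ρ` is a probability measure, so that `E[ρ]` is then a well-defined
element of `ℝ ∪ {∞}`. -/
noncomputable def interactionEnergy {d : ℕ} (W : EuclideanSpace ℝ (Fin d) → EReal)
    (ρ : Measure (EuclideanSpace ℝ (Fin d))) : EReal :=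
  ((1 / 2 : ℝ) : EReal) *
    (((∫⁻ x, ∫⁻ y, (W (x - y)).toENNReal ∂ρ ∂ρ : ENNReal) : EReal)
      - ((∫⁻ x, ∫⁻ y, (-W (x - y)).toENNReal ∂ρ ∂ρ : ENNReal) : EReal))

/-- `ρ` minimizes the interaction energy of `W` among all Borel probability measures on `ℝ^d`. -/
structure IsEnergyMinimizer {d : ℕ} (W : EuclideanSpace ℝ (Fin d) → EReal)
    (ρ : Measure (EuclideanSpace ℝ (Fin d))) : Prop where
  isProbabilityMeasure : IsProbabilityMeasure ρ
  energy_le : ∀ μ : Measure (EuclideanSpace ℝ (Fin d)), IsProbabilityMeasure μ →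
    interactionEnergy W ρ ≤ interactionEnergy W μ

/-- A minimizer of the interaction energy of `W` exists, and it is unique up to translation. -/
def HasUniqueMinimizerUpToTranslation {d : ℕ} (W : EuclideanSpace ℝ (Fin d) → EReal) : Prop :=
  (∃ ρ, IsEnergyMinimizer W ρ) ∧
    ∀ ρ₀ ρ₁, IsEnergyMinimizer W ρ₀ → IsEnergyMinimizer W ρ₁ →
      ∃ v : EuclideanSpace ℝ (Fin d), ρ₁ = ρ₀.map (fun x => x + v)

/-! For `c < 2` the function `-r ^ c / c` is, up to a constant, a positive mixture of Gaussians `exp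
(-t r ^ 2)` with density `κ_c t ^ (-c / 2 - 1)`, where `κ_c = 1 / (2 Γ(1 - c / 2))`. By Fourier
transform the Gaussian energy of `μ - ν` is nonnegative, so repulsion contributes a form `Q_b ≥ 0`
to the energy of `μ - ν` and attraction contributes `-Q_a` (`mixtureDist`). At `a = 2` the
attraction is quadratic and is not felt by differences of measures with the same centre of mass;
accordingly `κ_a → 0` as `a → 2`, and `Q_a` should be a small perturbation of `Q_b`.

This is `exists_mixtureDist_le`: `Q_a ≤ κ_a C Q_b` for centred probability measures in a fixed ball,
with `C` independent of `a`. For `t > 1` the densities compare directly. For `t ≤ 1`, equal masses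
and means make the characteristic functions differ by `O(|ξ| ^ 2)`, so the Gaussian energy is `O(t ^
2)`, and `t ^ 2 t ^ (-a / 2 - 1) ≤ 1`. The implied constant is a negative Sobolev norm of `μ - ν`
(`exists_norm_charFun_sub_sq_le`, which needs compact support), and `Q_b` dominates this norm
(`exists_sobolevDist_le_lintegral_gaussDist`).

Minimizers exist by the direct method (`exists_minimizer_pairEnergy`) and, up to translation, live
in a ball whose radius is uniform for `a` near `2` (`exists_ae_norm_sub_le_of_minimizer`). For two
centred minimizers, testing with their midpoint gives `Q_b ≤ Q_a`. Once `κ_a C < 1` this forces `Q_b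
= 0`, and the measures agree. -/

open Filter Topology
open scoped SchwartzMap FourierTransform ContDiff

/-! ### Mutual energies of nonnegative kernels, and reduction to them. -/

/-- The mutual energy `∫ ∫ V (x - y) dν(y) dμ(x)` of two measures, for a nonnegative kernel `V`. -/
noncomputable def pairEnergy {E : Type*} [MeasurableSpace E] [Sub E] (V : E → ENNReal)
    (μ ν : Measure E) : ENNReal :=
  ∫⁻ x, ∫⁻ y, V (x - y) ∂ν ∂μ

theorem pairEnergy_add_left {E : Type*} [MeasurableSpace E] [Sub E] (V : E → ENNReal)
    (μ₁ μ₂ ν : Measure E) :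
    pairEnergy V (μ₁ + μ₂) ν = pairEnergy V μ₁ ν + pairEnergy V μ₂ ν := by
  simp [pairEnergy, lintegral_add_measure]

theorem pairEnergy_smul_left {E : Type*} [MeasurableSpace E] [Sub E] (V : E → ENNReal)
    (c : ENNReal) (μ ν : Measure E) :
    pairEnergy V (c • μ) ν = c * pairEnergy V μ ν := by
  simp [pairEnergy]

section pairEnergy

variable {E : Type*} [MeasurableSpace E] [AddCommGroup E] [MeasurableSub₂ E]
  {V : E → ENNReal}

theorem measurable_pairKernel (hV : Measurable V) : Measurable fun p : E × E => V (p.1 - p.2) :=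
  hV.comp (measurable_fst.sub measurable_snd)

theorem measurable_potential (hV : Measurable V) (ν : Measure E) [SFinite ν] :
    Measurable fun x => ∫⁻ y, V (x - y) ∂ν :=
  (measurable_pairKernel hV).lintegral_prod_right'

theorem pairEnergy_comm (hV : Measurable V) (hneg : ∀ x, V (-x) = V x) (μ ν : Measure E)
    [SFinite μ] [SFinite ν] : pairEnergy V μ ν = pairEnergy V ν μ := by
  unfold pairEnergy
  rw [lintegral_lintegral_swap (measurable_pairKernel hV).aemeasurable]
  refine lintegral_congr fun y => lintegral_congr fun x => ?_
  rw [← hneg, neg_sub]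

theorem pairEnergy_map_add [MeasurableAdd₂ E] (hV : Measurable V) (v : E) (μ ν : Measure E) [SFinite μ] [SFinite ν] :
    pairEnergy V (μ.map (· + v)) (ν.map (· + v)) = pairEnergy V μ ν := by
  have hv : Measurable fun x : E => x + v := measurable_id.add_const v
  unfold pairEnergy
  rw [lintegral_map (measurable_potential hV _) hv]
  refine lintegral_congr fun x => ?_
  rw [lintegral_map (f := fun y => V (x + v - y)) (hV.comp (measurable_const.sub measurable_id)) hv]
  simp

theorem pairEnergy_eq_lintegral_prod (hV : Measurable V) (μ ν : Measure E) [SFinite μ]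
    [SFinite ν] : pairEnergy V μ ν = ∫⁻ p, V (p.1 - p.2) ∂(μ.prod ν) :=
  (lintegral_prod _ (measurable_pairKernel hV).aemeasurable).symm

theorem pairEnergy_add_right (hV : Measurable V) (μ ν₁ ν₂ : Measure E) [SFinite ν₁] [SFinite ν₂] :
    pairEnergy V μ (ν₁ + ν₂) = pairEnergy V μ ν₁ + pairEnergy V μ ν₂ := by
  simp only [pairEnergy, lintegral_add_measure]
  rw [lintegral_add_left (measurable_potential hV ν₁)]

theorem pairEnergy_smul_right (hV : Measurable V) (c : ENNReal) (μ ν : Measure E) [SFinite ν] :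
    pairEnergy V μ (c • ν) = c * pairEnergy V μ ν := by
  simp only [pairEnergy, lintegral_smul_measure, smul_eq_mul]
  rw [lintegral_const_mul _ (measurable_potential hV ν)]

end pairEnergy

/-- Here `V` plays the role of `W + C`. The relation is written without differences, so that it
remains meaningful where `W = ⊤`. -/
theorem interactionEnergy_eq_of_shift {d : ℕ} {W : EuclideanSpace ℝ (Fin d) → EReal}
    {V : EuclideanSpace ℝ (Fin d) → ENNReal} (hV : Measurable V) {C : ℝ}
    (hle : ∀ x, (-W x).toENNReal ≤ ENNReal.ofReal C)
    (hshift : ∀ x, (W x).toENNReal + ENNReal.ofReal C = V x + (-W x).toENNReal)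
    (ρ : Measure (EuclideanSpace ℝ (Fin d))) [IsProbabilityMeasure ρ] :
    interactionEnergy W ρ
      = ((1 / 2 : ℝ) : EReal) * ((pairEnergy V ρ ρ : EReal) - (ENNReal.ofReal C : EReal)) := by
  have key : (∫⁻ x, ∫⁻ y, (W (x - y)).toENNReal ∂ρ ∂ρ) + ENNReal.ofReal C
      = pairEnergy V ρ ρ + ∫⁻ x, ∫⁻ y, (-W (x - y)).toENNReal ∂ρ ∂ρ := by
    calc _ = ∫⁻ x, ((∫⁻ y, (W (x - y)).toENNReal ∂ρ) + ENNReal.ofReal C) ∂ρ := by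
          rw [lintegral_add_right _ measurable_const]; simp
      _ = ∫⁻ x, ((∫⁻ y, V (x - y) ∂ρ) + ∫⁻ y, (-W (x - y)).toENNReal ∂ρ) ∂ρ := by
          refine lintegral_congr fun x => ?_
          rw [← lintegral_add_left (f := fun y => V (x - y))
            (hV.comp (measurable_const.sub measurable_id))]
          simp only [← hshift]
          rw [lintegral_add_right _ measurable_const]; simp
      _ = _ := by
          rw [lintegral_add_left (measurable_potential hV ρ)]; rfl
  have hNle : (∫⁻ x, ∫⁻ y, (-W (x - y)).toENNReal ∂ρ ∂ρ) ≤ ENNReal.ofReal C := by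
    calc _ ≤ ∫⁻ _, ∫⁻ _, ENNReal.ofReal C ∂ρ ∂ρ :=
          lintegral_mono fun x => lintegral_mono fun y => hle _
      _ = _ := by simp
  unfold interactionEnergy
  congr 1
  generalize (∫⁻ x, ∫⁻ y, (W (x - y)).toENNReal ∂ρ ∂ρ) = P at *
  generalize (∫⁻ x, ∫⁻ y, (-W (x - y)).toENNReal ∂ρ ∂ρ) = N at *
  generalize pairEnergy V ρ ρ = I at *
  have hc : ENNReal.ofReal C ≠ ⊤ := ENNReal.ofReal_ne_top
  generalize ENNReal.ofReal C = c at *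
  have hN : N ≠ ⊤ := ne_top_of_le_ne_top hc hNle
  lift c to NNReal using hc
  lift N to NNReal using hN
  by_cases hI : I = ⊤
  · subst hI
    have hPt : P = ⊤ := by
      rw [top_add] at key
      exact (ENNReal.add_eq_top.1 key).resolve_right ENNReal.coe_ne_top
    subst hPt
    change (⊤ : EReal) - ((N : ℝ) : EReal) = (⊤ : EReal) - ((c : ℝ) : EReal)
    simp
  · lift I to NNReal using hI
    have hPt : P ≠ ⊤ := by
      rintro rfl
      rw [top_add] at key
      exact (ENNReal.add_ne_top.2 ⟨ENNReal.coe_ne_top, ENNReal.coe_ne_top⟩) key.symm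
    lift P to NNReal using hPt
    have key' : (P : ℝ) + c = I + N := by exact_mod_cast key
    change ((P : ℝ) : EReal) - ((N : ℝ) : EReal) = ((I : ℝ) : EReal) - ((c : ℝ) : EReal)
    rw [← EReal.coe_sub, ← EReal.coe_sub]
    congr 1
    linarith

theorem isEnergyMinimizer_iff_of_shift {d : ℕ} {W : EuclideanSpace ℝ (Fin d) → EReal}
    {V : EuclideanSpace ℝ (Fin d) → ENNReal} (hV : Measurable V) {C : ℝ}
    (hle : ∀ x, (-W x).toENNReal ≤ ENNReal.ofReal C)
    (hshift : ∀ x, (W x).toENNReal + ENNReal.ofReal C = V x + (-W x).toENNReal)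
    (ρ : Measure (EuclideanSpace ℝ (Fin d))) :
    IsEnergyMinimizer W ρ ↔ IsProbabilityMeasure ρ ∧
      ∀ μ : Measure (EuclideanSpace ℝ (Fin d)), IsProbabilityMeasure μ →
        pairEnergy V ρ ρ ≤ pairEnergy V μ μ := by
  have hmono : ∀ I J : ENNReal,
      ((1 / 2 : ℝ) : EReal) * ((I : EReal) - (ENNReal.ofReal C : EReal))
        ≤ ((1 / 2 : ℝ) : EReal) * ((J : EReal) - (ENNReal.ofReal C : EReal)) ↔ I ≤ J := by
    intro I J
    have hc : ENNReal.ofReal C ≠ ⊤ := ENNReal.ofReal_ne_top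
    generalize ENNReal.ofReal C = c at *
    lift c to NNReal using hc
    have htop : ((1 / 2 : ℝ) : EReal) * (((⊤ : ENNReal) : EReal) - ((c : ENNReal) : EReal)) = ⊤ := by
      change ((1 / 2 : ℝ) : EReal) * ((⊤ : EReal) - ((c : ℝ) : EReal)) = ⊤
      rw [EReal.top_sub_coe, EReal.coe_mul_top_of_pos (by norm_num)]
    have hcoe : ∀ K : NNReal, ((1 / 2 : ℝ) : EReal) * (((K : ENNReal) : EReal)
        - ((c : ENNReal) : EReal)) = (((1 / 2) * ((K : ℝ) - c) : ℝ) : EReal) := fun K => by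
      rw [EReal.coe_mul, EReal.coe_sub]; rfl
    induction J using ENNReal.recTopCoe with
    | top => rw [htop]; exact iff_of_true le_top le_top
    | coe J =>
      induction I using ENNReal.recTopCoe with
      | top =>
        rw [htop, hcoe]
        exact iff_of_false (not_le.2 (EReal.coe_lt_top _)) (not_le.2 ENNReal.coe_lt_top)
      | coe I =>
        rw [hcoe, hcoe, EReal.coe_le_coe_iff, ENNReal.coe_le_coe, ← NNReal.coe_le_coe]
        constructor <;> intro h <;> linarith
  constructor
  · rintro ⟨h1, h2⟩
    refine ⟨h1, fun μ hμ => ?_⟩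
    have := h2 μ hμ
    rwa [interactionEnergy_eq_of_shift hV hle hshift ρ,
      interactionEnergy_eq_of_shift hV hle hshift μ, hmono] at this
  · rintro ⟨h1, h2⟩
    refine ⟨h1, fun μ hμ => ?_⟩
    rw [interactionEnergy_eq_of_shift hV hle hshift ρ,
      interactionEnergy_eq_of_shift hV hle hshift μ, hmono]
    exact h2 μ hμ

/-! ### Existence and compact support of minimizers. -/

/-- The truncations `min f n` are bounded and continuous, so their integrals are weakly continuous,
and a supremum of continuous functions is lower semicontinuous. -/
theorem lowerSemicontinuous_lintegral_probabilityMeasure {X : Type*} [TopologicalSpace X]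
    [MeasurableSpace X] [OpensMeasurableSpace X] {f : X → ENNReal} (hf : Continuous f) :
    LowerSemicontinuous fun μ : ProbabilityMeasure X => ∫⁻ x, f x ∂(μ : Measure X) := by
  have h1 : ∀ μ : ProbabilityMeasure X, ∫⁻ x, f x ∂(μ : Measure X)
      = ⨆ n : ℕ, ∫⁻ x, min (f x) n ∂(μ : Measure X) := by
    intro μ
    rw [← lintegral_iSup (fun n => hf.measurable.min measurable_const)]
    · refine lintegral_congr fun x => ?_
      rw [← inf_iSup_eq, ENNReal.iSup_natCast, inf_top_eq]
    · intro m n hmn x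
      exact min_le_min le_rfl (by exact_mod_cast hmn)
  simp_rw [h1]
  refine lowerSemicontinuous_iSup fun n => Continuous.lowerSemicontinuous ?_
  have hne : ∀ x, min (f x) (n : ENNReal) ≠ ⊤ := fun x =>
    ((min_le_right _ _).trans_lt (ENNReal.natCast_lt_top n)).ne
  let g : BoundedContinuousFunction X NNReal := BoundedContinuousFunction.mkOfBound
    ⟨fun x => (min (f x) (n : ENNReal)).toNNReal, by
      have : Continuous fun x => min (f x) (n : ENNReal) := hf.min continuous_const
      exact continuous_iff_continuousAt.2 fun x =>
        (ENNReal.tendsto_toNNReal (hne x)).comp this.continuousAt⟩ n (by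
      intro x y
      have hb : ∀ x, (min (f x) (n : ENNReal)).toNNReal ≤ n := fun x => by
        have := ENNReal.toNNReal_mono (ENNReal.natCast_ne_top n) (min_le_right (f x) n)
        simpa using this
      have hx : ((min (f x) (n : ENNReal)).toNNReal : ℝ) ≤ n := by exact_mod_cast hb x
      have hy : ((min (f y) (n : ENNReal)).toNNReal : ℝ) ≤ n := by exact_mod_cast hb y
      change dist (min (f x) (n : ENNReal)).toNNReal (min (f y) (n : ENNReal)).toNNReal ≤ n
      rw [NNReal.dist_eq, abs_le]
      constructor <;> linarith [NNReal.coe_nonneg (min (f x) (n : ENNReal)).toNNReal,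
        NNReal.coe_nonneg (min (f y) (n : ENNReal)).toNNReal])
  have h2 : ∀ μ : ProbabilityMeasure X, ∫⁻ x, min (f x) n ∂(μ : Measure X)
      = (μ.toFiniteMeasure.testAgainstNN g : ENNReal) := by
    intro μ
    rw [FiniteMeasure.testAgainstNN_coe_eq]
    refine lintegral_congr fun x => ?_
    exact (ENNReal.coe_toNNReal (hne x)).symm
  simp_rw [h2]
  exact ENNReal.continuous_coe.comp (ProbabilityMeasure.continuous_testAgainstNN_eval g)

/-- Direct method: translation invariance is the only loss of compactness, and it is removed by
placing a point of low potential at the origin. Growth of `V` then gives tightness, and Prokhorov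
gives compactness. -/
theorem exists_minimizer_pairEnergy {E : Type*} [NormedAddCommGroup E] [ProperSpace E]
    [SecondCountableTopology E] [MeasurableSpace E] [BorelSpace E] {V : E → ENNReal}
    (hV : Continuous V) (hneg : ∀ x, V (-x) = V x)
    (hgrow : ∀ K : NNReal, ∃ L : ℝ, ∀ x, L < ‖x‖ → (K : ENNReal) ≤ V x)
    (hfin : ∃ μ : Measure E, IsProbabilityMeasure μ ∧ pairEnergy V μ μ ≠ ⊤) :
    ∃ ρ : Measure E, IsProbabilityMeasure ρ ∧
      ∀ μ : Measure E, IsProbabilityMeasure μ → pairEnergy V ρ ρ ≤ pairEnergy V μ μ := by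
  obtain ⟨μ₀, hμ₀, hfin⟩ := hfin
  set K := pairEnergy V μ₀ μ₀ with hK
  let S : Set (ProbabilityMeasure E) := {μ | ∫⁻ y, V y ∂(μ : Measure E) ≤ K}
  have htrans : ∀ μ : Measure E, IsProbabilityMeasure μ → pairEnergy V μ μ ≤ K →
      ∃ ν ∈ S, pairEnergy V (ν : Measure E) ν = pairEnergy V μ μ := by
    intro μ hμ hle
    -- Somewhere the potential does not exceed its mean, which is the energy; this point is moved to
    -- the origin.
    obtain ⟨x, hx⟩ := exists_le_lintegral (μ := μ) (measurable_potential hV.measurable μ).aemeasurable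
    have hm : Measurable fun y : E => y + -x := measurable_id.add_const _
    refine ⟨⟨μ.map (· + -x), Measure.isProbabilityMeasure_map hm.aemeasurable⟩, ?_,
      pairEnergy_map_add hV.measurable _ _ _⟩
    change ∫⁻ y, V y ∂(μ.map (· + -x)) ≤ K
    rw [lintegral_map hV.measurable hm]
    refine le_trans (le_of_eq ?_) (hx.trans hle)
    refine lintegral_congr fun y => ?_
    rw [← hneg]; congr 1; abel
  have htight : IsTightMeasureSet {((μ : ProbabilityMeasure E) : Measure E) | μ ∈ S} := by
    rw [isTightMeasureSet_iff_exists_isCompact_measure_compl_le]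
    intro ε hε
    by_cases hεt : ε = ⊤
    · exact ⟨∅, isCompact_empty, fun μ _ => hεt ▸ le_top⟩
    have hq : K / ε + 1 ≠ ⊤ := ENNReal.add_ne_top.2 ⟨ENNReal.div_ne_top hfin hε.ne', by simp⟩
    -- By Markov, the mass where `V` exceeds this level is at most `K / (K / ε + 1) ≤ ε`; the `1`
    -- keeps the level positive if `K = 0`.
    obtain ⟨L, hL⟩ := hgrow (K / ε + 1).toNNReal
    rw [ENNReal.coe_toNNReal hq] at hL
    refine ⟨Metric.closedBall 0 L, isCompact_closedBall _ _, ?_⟩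
    rintro _ ⟨μ, hμ, rfl⟩
    have hsub : (Metric.closedBall (0 : E) L)ᶜ ⊆ {y | K / ε + 1 ≤ V y} := by
      intro y hy
      refine hL y ?_
      simpa using hy
    refine (measure_mono hsub).trans ((meas_ge_le_lintegral_div hV.measurable.aemeasurable
      (by simp) hq).trans ?_)
    refine ENNReal.div_le_of_le_mul ?_
    refine le_trans hμ ?_
    rw [mul_add, ENNReal.mul_div_cancel hε.ne' hεt]
    exact le_self_add
  have hlsc : LowerSemicontinuous fun μ : ProbabilityMeasure E =>
      pairEnergy V (μ : Measure E) μ := by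
    have h1 : (fun μ : ProbabilityMeasure E => pairEnergy V (μ : Measure E) μ)
        = (fun ν : ProbabilityMeasure (E × E) =>
          ∫⁻ p, V (p.1 - p.2) ∂(ν : Measure (E × E))) ∘ fun μ => μ.prod μ := by
      funext μ
      exact pairEnergy_eq_lintegral_prod hV.measurable _ _
    rw [h1]
    refine LowerSemicontinuous.comp
      (lowerSemicontinuous_lintegral_probabilityMeasure (by fun_prop)) ?_
    exact ProbabilityMeasure.continuous_prod.comp (continuous_id.prodMk continuous_id)
  obtain ⟨ν₀, hν₀, hν₀e⟩ := htrans μ₀ hμ₀ le_rfl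
  obtain ⟨ρ, -, hmin⟩ := LowerSemicontinuousOn.exists_isMinOn ⟨ν₀, subset_closure hν₀⟩
    (isCompact_closure_of_isTightMeasureSet htight) (hlsc.lowerSemicontinuousOn _)
  rw [isMinOn_iff] at hmin
  refine ⟨ρ, inferInstance, fun μ hμ => ?_⟩
  by_cases hle : pairEnergy V μ μ ≤ K
  · obtain ⟨ν, hν, hνe⟩ := htrans μ hμ hle
    rw [← hνe]
    exact hmin ν (subset_closure hν)
  · have := hmin ν₀ (subset_closure hν₀)
    rw [hν₀e] at this
    exact this.trans (not_le.1 hle).le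

/-- If the set `A` of high potential had mass `m > 0`, discarding it and renormalizing would lower
the energy: minimality on `Aᶜ` gives `I (1 - m) ^ 2 + 2 I m < I`, whereas the left side is `I (1 + m
^ 2)`. -/
theorem ae_potential_le_of_minimizer {E : Type*} [MeasurableSpace E] [AddCommGroup E]
    [MeasurableSub₂ E] {V : E → ENNReal} (hV : Measurable V)
    {ρ : Measure E} [IsProbabilityMeasure ρ]
    (hmin : ∀ μ : Measure E, IsProbabilityMeasure μ → pairEnergy V ρ ρ ≤ pairEnergy V μ μ)
    (hfin : pairEnergy V ρ ρ ≠ ⊤) :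
    ∀ᵐ x ∂ρ, ∫⁻ y, V (x - y) ∂ρ ≤ 2 * pairEnergy V ρ ρ := by
  set I := pairEnergy V ρ ρ with hI
  have hφ := measurable_potential hV ρ
  set A : Set E := {x | 2 * I < ∫⁻ y, V (x - y) ∂ρ} with hA
  have hAm : MeasurableSet A := measurableSet_lt measurable_const hφ
  have h2I : 2 * I ≠ ⊤ := ENNReal.mul_ne_top (by simp) hfin
  rw [ae_iff]
  simp only [not_le]
  by_contra hA0
  change ρ A ≠ 0 at hA0
  have hstrict : 2 * I * ρ A < ∫⁻ x in A, ∫⁻ y, V (x - y) ∂ρ ∂ρ := by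
    rw [← setLIntegral_const]
    refine setLIntegral_strict_mono hAm hA0 hφ ?_ (Eventually.of_forall fun x hx => hx)
    rw [setLIntegral_const]
    exact ENNReal.mul_ne_top h2I (measure_ne_top _ _)
  have hsplit : ρ = ρ.restrict Aᶜ + ρ.restrict A := by
    rw [add_comm]; exact (Measure.restrict_add_restrict_compl hAm).symm
  have hAeq : ∫⁻ x in A, ∫⁻ y, V (x - y) ∂ρ ∂ρ = pairEnergy V (ρ.restrict A) ρ := rfl
  have hle : pairEnergy V (ρ.restrict Aᶜ) (ρ.restrict Aᶜ) + pairEnergy V (ρ.restrict A) ρ ≤ I := by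
    have h1 : I = pairEnergy V (ρ.restrict Aᶜ) ρ + pairEnergy V (ρ.restrict A) ρ := by
      rw [hI, ← pairEnergy_add_left, ← hsplit]
    rw [h1]
    refine add_le_add ?_ le_rfl
    exact lintegral_mono fun x => lintegral_mono' Measure.restrict_le_self le_rfl
  have hsum : ρ A + ρ Aᶜ = 1 := by rw [measure_add_measure_compl hAm]; simp
  have hlow : I * ρ Aᶜ * ρ Aᶜ ≤ pairEnergy V (ρ.restrict Aᶜ) (ρ.restrict Aᶜ) := by
    by_cases hB : ρ Aᶜ = 0
    · simp [hB]
    · have hBt : ρ Aᶜ ≠ ⊤ := measure_ne_top _ _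
      have hp : IsProbabilityMeasure ((ρ Aᶜ)⁻¹ • ρ.restrict Aᶜ) := by
        constructor
        simp [ENNReal.inv_mul_cancel hB hBt]
      have := hmin _ hp
      rw [pairEnergy_smul_left, pairEnergy_smul_right hV] at this
      calc I * ρ Aᶜ * ρ Aᶜ ≤ ((ρ Aᶜ)⁻¹ * ((ρ Aᶜ)⁻¹
            * pairEnergy V (ρ.restrict Aᶜ) (ρ.restrict Aᶜ))) * ρ Aᶜ * ρ Aᶜ := by gcongr
        _ = ((ρ Aᶜ)⁻¹ * ρ Aᶜ) * ((ρ Aᶜ)⁻¹ * ρ Aᶜ)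
            * pairEnergy V (ρ.restrict Aᶜ) (ρ.restrict Aᶜ) := by ring
        _ = _ := by rw [ENNReal.inv_mul_cancel hB hBt]; simp
  have hlt : I * ρ Aᶜ * ρ Aᶜ + 2 * I * ρ A < I := by
    rw [hAeq] at hstrict
    refine lt_of_lt_of_le ?_ hle
    refine ENNReal.add_lt_add_of_le_of_lt ?_ hlow hstrict
    exact ENNReal.mul_ne_top (ENNReal.mul_ne_top hfin (measure_ne_top _ _)) (measure_ne_top _ _)
  have hAt : ρ A ≠ ⊤ := measure_ne_top _ _
  have hBt : ρ Aᶜ ≠ ⊤ := measure_ne_top _ _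
  generalize ρ A = m at *
  generalize ρ Aᶜ = β at *
  generalize I = J at *
  lift m to NNReal using hAt
  lift β to NNReal using hBt
  lift J to NNReal using hfin
  have h1 : (m : ℝ) + β = 1 := by exact_mod_cast hsum
  have h2 : (J : ℝ) * β * β + 2 * J * m < J := by exact_mod_cast hlt
  have h3 : (β : ℝ) = 1 - m := by linarith
  rw [h3] at h2
  nlinarith [mul_nonneg J.coe_nonneg (sq_nonneg (m : ℝ))]

/-- At a point of potential at most `2 K`, Markov leaves mass at most `2 K / (4 K + 1) < 1 / 2`
outside the ball of radius `L`. Two balls of mass above `1 / 2` must meet, so almost all points are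
within `2 L` of one another. -/
theorem exists_ae_norm_sub_le_of_minimizer {E : Type*} [NormedAddCommGroup E]
    [SecondCountableTopology E] [MeasurableSpace E] [BorelSpace E] {V : E → ENNReal}
    (hV : Measurable V) {K : NNReal} {L : ℝ}
    (hgrow : ∀ x, L < ‖x‖ → ((4 * K + 1 : NNReal) : ENNReal) ≤ V x)
    {ρ : Measure E} [IsProbabilityMeasure ρ]
    (hmin : ∀ μ : Measure E, IsProbabilityMeasure μ → pairEnergy V ρ ρ ≤ pairEnergy V μ μ)
    (hK : pairEnergy V ρ ρ ≤ K) : ∃ x₀, ∀ᵐ x ∂ρ, ‖x - x₀‖ ≤ 2 * L := by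
  have hφ : ∀ᵐ x ∂ρ, ∫⁻ y, V (x - y) ∂ρ ≤ 2 * K := by
    filter_upwards [ae_potential_le_of_minimizer hV hmin
      (ne_top_of_le_ne_top ENNReal.coe_ne_top hK)] with x hx
    exact hx.trans (by gcongr)
  have hball : ∀ x, ∫⁻ y, V (x - y) ∂ρ ≤ 2 * K → 1 / 2 < ρ (Metric.closedBall x L) := by
    intro x hx
    have hc : ρ (Metric.closedBall x L)ᶜ < 1 / 2 := by
      have hsub : (Metric.closedBall x L)ᶜ ⊆ {y | ((4 * K + 1 : NNReal) : ENNReal) ≤ V (x - y)} := by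
        intro y hy
        refine hgrow _ ?_
        rw [Set.mem_compl_iff, Metric.mem_closedBall, not_le, dist_comm, dist_eq_norm] at hy
        exact hy
      refine (measure_mono hsub).trans_lt ((meas_ge_le_lintegral_div
        (f := fun y => V (x - y))
        (hV.comp (measurable_const.sub measurable_id)).aemeasurable
        (by simp) ENNReal.coe_ne_top).trans_lt ?_)
      refine (ENNReal.div_le_div_right hx _).trans_lt ?_
      refine ENNReal.div_lt_of_lt_mul ?_
      rw [one_div, mul_comm _ ((4 * K + 1 : NNReal) : ENNReal), ← div_eq_mul_inv, ENNReal.lt_div_iff_mul_lt (by simp) (by simp)]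
      have : ((2 * K * 2 : NNReal)) < 4 * K + 1 := by
        rw [← NNReal.coe_lt_coe]; push_cast; linarith
      exact_mod_cast this
    by_contra hle
    rw [not_lt] at hle
    have h1 : ρ (Metric.closedBall x L) + ρ (Metric.closedBall x L)ᶜ = 1 := by
      rw [measure_add_measure_compl Metric.isClosed_closedBall.measurableSet]; simp
    have h2 : ρ (Metric.closedBall x L) + ρ (Metric.closedBall x L)ᶜ < 1 / 2 + 1 / 2 :=
      ENNReal.add_lt_add_of_le_of_lt (measure_ne_top _ _) hle hc
    rw [h1, ENNReal.add_halves] at h2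
    exact lt_irrefl _ h2
  obtain ⟨x₀, hx₀⟩ := hφ.exists
  refine ⟨x₀, ?_⟩
  filter_upwards [hφ] with x hx
  have hne : (Metric.closedBall x L ∩ Metric.closedBall x₀ L).Nonempty := by
    refine nonempty_inter_of_measure_lt_add ρ Metric.isClosed_closedBall.measurableSet
      (Set.subset_univ _) (Set.subset_univ _) ?_
    rw [measure_univ, ← ENNReal.add_halves 1]
    exact ENNReal.add_lt_add (hball x hx) (hball x₀ hx₀)
  obtain ⟨y, hy1, hy2⟩ := hne
  rw [Metric.mem_closedBall] at hy1 hy2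
  rw [← dist_eq_norm]
  linarith [dist_triangle_left x x₀ y]

/-! ### The power-law kernel and bounds uniform in `a`. -/

theorem hasDerivAt_powerTerm (c : ℝ) {r : ℝ} (hr : 0 < r) :
    HasDerivAt (powerTerm c) (r ^ (c - 1)) r := by
  by_cases hc : c = 0
  · subst hc
    have : powerTerm 0 = Real.log := by funext r; simp [powerTerm]
    rw [this, zero_sub, Real.rpow_neg_one]
    exact Real.hasDerivAt_log hr.ne'
  · have : powerTerm c = fun r => r ^ c / c := by funext r; simp [powerTerm, hc]
    rw [this]
    have h := (Real.hasDerivAt_rpow_const (p := c) (Or.inl hr.ne')).div_const c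
    rwa [mul_div_cancel_left₀ _ hc] at h

theorem powerTerm_zero_right {c : ℝ} (hc : 0 < c) : powerTerm c 0 = 0 := by
  simp [powerTerm, hc.ne']

theorem powerTerm_one_right {c : ℝ} (hc : 0 < c) : powerTerm c 1 = 1 / c := by
  simp [powerTerm, hc.ne']

theorem powerTerm_nonneg {c r : ℝ} (hc : 0 < c) (hr : 0 ≤ r) : 0 ≤ powerTerm c r := by
  simp only [powerTerm, hc.ne', if_false]
  positivity

theorem continuousOn_powerTerm (c : ℝ) : ContinuousOn (powerTerm c) (Set.Ioi 0) := fun _ hr =>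
  (hasDerivAt_powerTerm c hr).continuousAt.continuousWithinAt

theorem continuous_powerTerm {c : ℝ} (hc : 0 < c) : Continuous (powerTerm c) := by
  have : powerTerm c = fun r => r ^ c / c := by funext r; simp [powerTerm, hc.ne']
  rw [this]
  exact (Real.continuous_rpow_const hc.le).div_const c

theorem measurable_powerTerm (c : ℝ) : Measurable (powerTerm c) := by
  unfold powerTerm
  split_ifs
  · exact Real.measurable_log
  · fun_prop

theorem monotoneOn_powerTerm (c : ℝ) : MonotoneOn (powerTerm c) (Set.Ioi 0) := by
  refine monotoneOn_of_deriv_nonneg (convex_Ioi 0) (continuousOn_powerTerm c) ?_ ?_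
  · rw [interior_Ioi]
    exact fun r hr => (hasDerivAt_powerTerm c hr).differentiableAt.differentiableWithinAt
  · rw [interior_Ioi]
    intro r hr
    rw [(hasDerivAt_powerTerm c hr).deriv]
    exact Real.rpow_nonneg (le_of_lt hr) _

theorem monotoneOn_powerTerm_sub {a b : ℝ} (hab : b ≤ a) :
    MonotoneOn (fun r => powerTerm a r - powerTerm b r) (Set.Ici 1) := by
  have hd : ∀ r ∈ Set.Ici (1 : ℝ), HasDerivAt (fun r => powerTerm a r - powerTerm b r)
      (r ^ (a - 1) - r ^ (b - 1)) r := fun r hr =>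
    (hasDerivAt_powerTerm a (zero_lt_one.trans_le hr)).sub
      (hasDerivAt_powerTerm b (zero_lt_one.trans_le hr))
  refine monotoneOn_of_deriv_nonneg (convex_Ici 1)
    (fun r hr => (hd r hr).continuousAt.continuousWithinAt) ?_ ?_
  · exact fun r hr => (hd r (interior_subset hr)).differentiableAt.differentiableWithinAt
  · intro r hr
    rw [(hd r (interior_subset hr)).deriv, sub_nonneg]
    exact Real.rpow_le_rpow_of_exponent_le (interior_subset hr) (by linarith)

theorem antitoneOn_powerTerm_sub {a b : ℝ} (hab : b ≤ a) :
    AntitoneOn (fun r => powerTerm a r - powerTerm b r) (Set.Ioc 0 1) := by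
  have hd : ∀ r ∈ Set.Ioc (0 : ℝ) 1, HasDerivAt (fun r => powerTerm a r - powerTerm b r)
      (r ^ (a - 1) - r ^ (b - 1)) r := fun r hr =>
    (hasDerivAt_powerTerm a hr.1).sub (hasDerivAt_powerTerm b hr.1)
  refine antitoneOn_of_deriv_nonpos (convex_Ioc 0 1)
    (fun r hr => (hd r hr).continuousAt.continuousWithinAt) ?_ ?_
  · exact fun r hr => (hd r (interior_subset hr)).differentiableAt.differentiableWithinAt
  · intro r hr
    have hr' := interior_subset hr
    rw [(hd r hr').deriv, sub_nonpos]
    exact Real.rpow_le_rpow_of_exponent_ge hr'.1 hr'.2 (by linarith)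

theorem neg_abs_le_powerTerm_sub {a b r : ℝ} (ha : 0 < a) (hab : b < a) (hr : 0 ≤ r)
    (hb : 0 < r ∨ 0 < b) : -|powerTerm b 1| ≤ powerTerm a r - powerTerm b r := by
  have h1 := le_abs_self (powerTerm b 1)
  rcases le_or_gt 1 r with h | h
  · have := monotoneOn_powerTerm_sub hab.le (Set.mem_Ici.2 le_rfl) (Set.mem_Ici.2 h) h
    simp only at this
    have h2 := powerTerm_nonneg ha zero_le_one
    linarith
  · have h2 := powerTerm_nonneg ha hr
    have h3 : powerTerm b r ≤ powerTerm b 1 := by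
      rcases hr.eq_or_lt with h0 | h0
      · rw [← h0] at hb ⊢
        have hb' : 0 < b := hb.resolve_left (lt_irrefl _)
        rw [powerTerm_zero_right hb']
        exact powerTerm_nonneg hb' zero_le_one
      · exact monotoneOn_powerTerm b h0 (Set.mem_Ioi.2 one_pos) h.le
    linarith

theorem tendsto_powerTerm_sub_atTop {a b : ℝ} (ha : 0 < a) (hab : b < a) :
    Tendsto (fun r => powerTerm a r - powerTerm b r) atTop atTop := by
  -- A positive exponent between `b` and `a` avoids a case distinction on the sign of `b`.
  obtain ⟨b', hb', hb'a⟩ := exists_between (max_lt ha hab)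
  have h0 : 0 < b' := (le_max_left _ _).trans_lt hb'
  have hb : b < b' := (le_max_right _ _).trans_lt hb'
  have h1 : Tendsto (fun r : ℝ => r ^ b' * (r ^ (a - b') / a - 1 / b')
      + (powerTerm b' 1 - powerTerm b 1)) atTop atTop := by
    refine tendsto_atTop_add_const_right _ _ ?_
    refine (tendsto_rpow_atTop h0).atTop_mul_atTop₀ ?_
    refine tendsto_atTop_add_const_right _ _ ?_
    exact (tendsto_rpow_atTop (by linarith)).atTop_div_const ha
  refine tendsto_atTop_mono' _ ?_ h1
  filter_upwards [eventually_ge_atTop 1] with r hr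
  have h2 := monotoneOn_powerTerm_sub hb.le (Set.mem_Ici.2 le_rfl) (Set.mem_Ici.2 hr) hr
  simp only at h2
  have h3 : r ^ b' * (r ^ (a - b') / a - 1 / b') = powerTerm a r - powerTerm b' r := by
    simp only [powerTerm, ha.ne', h0.ne', if_false]
    rw [mul_sub, ← mul_div_assoc, ← Real.rpow_add (by linarith)]
    rw [add_sub_cancel]; ring
  rw [h3]
  linarith

theorem tendsto_powerTerm_nhdsGT_zero {b : ℝ} (hb : b ≤ 0) :
    Tendsto (powerTerm b) (𝓝[>] 0) atBot := by
  rcases hb.eq_or_lt with rfl | hb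
  · have : powerTerm 0 = Real.log := by funext r; simp [powerTerm]
    rw [this]
    exact Real.tendsto_log_nhdsGT_zero
  · have : powerTerm b = fun r => r ^ b / b := by funext r; simp [powerTerm, hb.ne]
    rw [this]
    exact (tendsto_rpow_neg_nhdsGT_zero hb).atTop_div_const_of_neg hb

/-- The power-law potential shifted by a constant so as to be nonnegative. -/
noncomputable def shiftedKernel (d : ℕ) (a b : ℝ) (x : EuclideanSpace ℝ (Fin d)) : ENNReal :=
  if x = 0 ∧ b ≤ 0 then ⊤
  else ENNReal.ofReal (powerTerm a ‖x‖ - powerTerm b ‖x‖ + |powerTerm b 1|)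

section shiftedKernel

variable {d : ℕ} {a b : ℝ}

theorem shiftedKernel_neg (x : EuclideanSpace ℝ (Fin d)) :
    shiftedKernel d a b (-x) = shiftedKernel d a b x := by
  simp [shiftedKernel]

/-- For `b ≤ 0` the value `⊤` at the origin is the limit there, so continuity into `ENNReal`
survives the singularity. -/
theorem continuous_shiftedKernel (ha : 0 < a) : Continuous (shiftedKernel d a b) := by
  have hoff : ∀ x : EuclideanSpace ℝ (Fin d), x ≠ 0 →
      ContinuousAt (fun x => ENNReal.ofReal (powerTerm a ‖x‖ - powerTerm b ‖x‖ + |powerTerm b 1|))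
        x := by
    intro x hx
    have hx' : 0 < ‖x‖ := norm_pos_iff.2 hx
    have h1 := (hasDerivAt_powerTerm a hx').continuousAt.comp (f := fun x => ‖x‖)
      continuous_norm.continuousAt
    have h2 := (hasDerivAt_powerTerm b hx').continuousAt.comp (f := fun x => ‖x‖)
      continuous_norm.continuousAt
    exact ENNReal.continuous_ofReal.continuousAt.comp ((h1.sub h2).add continuousAt_const)
  by_cases hb : b ≤ 0
  · rw [continuous_iff_continuousAt]
    intro x
    by_cases hx : x = 0
    · subst hx
      rw [continuousAt_iff_punctured_nhds]
      have h0 : shiftedKernel d a b 0 = ⊤ := by simp [shiftedKernel, hb]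
      rw [h0]
      have hn : Tendsto (fun x : EuclideanSpace ℝ (Fin d) => ‖x‖) (𝓝[≠] 0) (𝓝[>] 0) :=
        tendsto_norm_nhdsNE_zero
      have hr : Tendsto (fun r => powerTerm a r - powerTerm b r + |powerTerm b 1|) (𝓝[>] 0)
          atTop := by
        refine tendsto_atTop_add_const_right _ _ ?_
        have h1 : Tendsto (powerTerm a) (𝓝[>] 0) (𝓝 (powerTerm a 0)) :=
          (continuous_powerTerm ha).continuousAt.tendsto.mono_left nhdsWithin_le_nhds
        have h2 := tendsto_neg_atBot_atTop.comp (tendsto_powerTerm_nhdsGT_zero hb)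
        simpa [sub_eq_add_neg] using h1.add_atTop h2
      refine (ENNReal.tendsto_ofReal_atTop.comp (hr.comp hn)).congr' ?_
      filter_upwards [self_mem_nhdsWithin] with y hy
      have hy' : y ≠ 0 := hy
      simp [shiftedKernel, hy']
    · refine (hoff x hx).congr ?_
      filter_upwards [isOpen_ne.mem_nhds hx] with y hy
      simp [shiftedKernel, hy]
  · have : shiftedKernel d a b = fun x =>
        ENNReal.ofReal (powerTerm a ‖x‖ - powerTerm b ‖x‖ + |powerTerm b 1|) := by
      funext x; simp [shiftedKernel, hb]
    rw [this]
    have h1 := (continuous_powerTerm ha).comp (continuous_norm (E := EuclideanSpace ℝ (Fin d)))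
    have h2 := (continuous_powerTerm (not_le.1 hb)).comp
      (continuous_norm (E := EuclideanSpace ℝ (Fin d)))
    exact ENNReal.continuous_ofReal.comp ((h1.sub h2).add continuous_const)

theorem isEnergyMinimizer_powerLawPotential_iff (ha : 0 < a) (hab : b < a)
    (ρ : Measure (EuclideanSpace ℝ (Fin d))) :
    IsEnergyMinimizer (powerLawPotential d a b) ρ ↔ IsProbabilityMeasure ρ ∧
      ∀ μ : Measure (EuclideanSpace ℝ (Fin d)), IsProbabilityMeasure μ →
        pairEnergy (shiftedKernel d a b) ρ ρ ≤ pairEnergy (shiftedKernel d a b) μ μ := by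
  have hlow : ∀ x : EuclideanSpace ℝ (Fin d), ¬ (x = 0 ∧ b ≤ 0) →
      -|powerTerm b 1| ≤ powerTerm a ‖x‖ - powerTerm b ‖x‖ := by
    intro x hx
    refine neg_abs_le_powerTerm_sub ha hab (norm_nonneg _) ?_
    by_cases h0 : x = 0
    · exact Or.inr (not_le.1 fun h => hx ⟨h0, h⟩)
    · exact Or.inl (norm_pos_iff.2 h0)
  refine isEnergyMinimizer_iff_of_shift (C := |powerTerm b 1|)
    (continuous_shiftedKernel ha).measurable (fun x => ?_) (fun x => ?_) ρ
  · by_cases hx : x = 0 ∧ b ≤ 0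
    · simp [powerLawPotential, hx]
    · simp only [powerLawPotential, hx, if_false]
      rw [← EReal.coe_neg, EReal.real_coe_toENNReal]
      exact ENNReal.ofReal_le_ofReal (by linarith [hlow x hx])
  · by_cases hx : x = 0 ∧ b ≤ 0
    · simp [powerLawPotential, shiftedKernel, hx]
    · simp only [powerLawPotential, shiftedKernel, hx, if_false]
      rw [← EReal.coe_neg, EReal.real_coe_toENNReal, EReal.real_coe_toENNReal]
      have h := hlow x hx
      generalize powerTerm a ‖x‖ - powerTerm b ‖x‖ = w at *
      have hC := abs_nonneg (powerTerm b 1)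
      generalize |powerTerm b 1| = C at *
      rcases le_total 0 w with hw | hw
      · rw [ENNReal.ofReal_of_nonpos (neg_nonpos.2 hw), add_zero, ENNReal.ofReal_add hw hC]
      · rw [ENNReal.ofReal_of_nonpos hw, zero_add, ← ENNReal.ofReal_add (by linarith)
          (by linarith)]
        congr 1; ring

/-- `L` does not depend on `a`: beyond radius `1`, raising the exponent from `a₀` to `a` lowers the
potential by at most `1 / a₀ - 1 / a ≤ 1`. -/
theorem exists_forall_le_shiftedKernel {a₀ : ℝ} (ha₀ : 1 ≤ a₀) (hb : b < a₀) (K : NNReal) :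
    ∃ L : ℝ, 1 ≤ L ∧ ∀ a, a₀ < a → a < 2 → ∀ x : EuclideanSpace ℝ (Fin d), L < ‖x‖ →
      (K : ENNReal) ≤ shiftedKernel d a b x := by
  have h := (tendsto_powerTerm_sub_atTop (by linarith) hb).eventually_ge_atTop ((K : ℝ) + 1)
  obtain ⟨L, hL⟩ := eventually_atTop.1 h
  refine ⟨max L 1, le_max_right _ _, fun a ha ha2 x hx => ?_⟩
  have hx1 : 1 < ‖x‖ := (le_max_right _ _).trans_lt hx
  have hx0 : x ≠ 0 := norm_pos_iff.1 (by linarith)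
  simp only [shiftedKernel, hx0, false_and, if_false]
  rw [← ENNReal.ofReal_coe_nnreal]
  refine ENNReal.ofReal_le_ofReal ?_
  have h1 := hL ‖x‖ ((le_max_left _ _).trans hx.le)
  have h2 := monotoneOn_powerTerm_sub ha.le (Set.mem_Ici.2 le_rfl) (Set.mem_Ici.2 hx1.le) hx1.le
  simp only at h2
  rw [powerTerm_one_right (by linarith), powerTerm_one_right (by linarith)] at h2
  have h3 : 1 / a₀ ≤ 1 := by rw [div_le_one (by linarith)]; exact ha₀
  have h4 : 0 < 1 / a := by have : 0 < a := by linarith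
                            positivity
  linarith [abs_nonneg (powerTerm b 1)]

theorem lintegral_ball_rpow_norm_ne_top (hd : 1 ≤ d) (hbd : -(d : ℝ) < b) (c : ℝ) :
    ∫⁻ x in Metric.ball (0 : EuclideanSpace ℝ (Fin d)) 1,
      ENNReal.ofReal (c + ‖x‖ ^ b) ≠ ⊤ := by
  have hne : Nonempty (Fin d) := ⟨⟨0, hd⟩⟩
  have h1 : IntegrableOn (fun x : EuclideanSpace ℝ (Fin d) => ‖x‖ ^ b) (Metric.ball 0 1) := by
    rw [integrableOn_fun_norm_addHaar volume (f := fun r : ℝ => r ^ b)]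
    rw [integrableOn_congr_fun (g := fun r : ℝ => r ^ ((d : ℝ) - 1 + b)) _ measurableSet_Ioo]
    · rw [intervalIntegral.integrableOn_Ioo_rpow_iff one_pos]
      linarith
    · intro r hr
      simp only [finrank_euclideanSpace, Fintype.card_fin, smul_eq_mul]
      rw [Real.rpow_add hr.1, ← Real.rpow_natCast, Nat.cast_sub hd, Nat.cast_one]
  have h2 : IntegrableOn (fun x : EuclideanSpace ℝ (Fin d) => c + ‖x‖ ^ b) (Metric.ball 0 1) :=
    (integrableOn_const (by exact measure_ball_lt_top.ne)).add h1
  exact h2.lintegral_lt_top.ne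

/-- The trial measure is uniform on the ball of radius `1 / 2`, whose differences stay in the unit
ball, where the kernel has a locally integrable bound independent of `a`. -/
theorem exists_pairEnergy_shiftedKernel_le (hd : 1 ≤ d) (hbd : -(d : ℝ) < b) :
    ∃ (μ : Measure (EuclideanSpace ℝ (Fin d))) (K : NNReal), IsProbabilityMeasure μ ∧
      ∀ a, 1 ≤ a → pairEnergy (shiftedKernel d a b) μ μ ≤ K := by
  have hne : Nonempty (Fin d) := ⟨⟨0, hd⟩⟩
  -- A negative exponent `b' < b` that is still integrable treats all signs of `b` at once.
  obtain ⟨b', hb'd, hb'⟩ := exists_between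
    (lt_min hbd (show -(d : ℝ) < 0 by simpa using (by omega : 0 < d)))
  have hb'b : b' < b := hb'.trans_le (min_le_left _ _)
  have hb'0 : b' < 0 := hb'.trans_le (min_le_right _ _)
  -- `1` bounds `powerTerm a` on the unit ball; one `|powerTerm b 1|` is the shift, the other comes
  -- from comparing `b` with `b'` at radius `1`.
  set c : ℝ := 1 + 2 * |powerTerm b 1| with hc
  set M := ∫⁻ x in Metric.ball (0 : EuclideanSpace ℝ (Fin d)) 1,
    ENNReal.ofReal (-1 / b') * ENNReal.ofReal (c * (-b') + ‖x‖ ^ b') with hM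
  have hMt : M ≠ ⊤ := by
    rw [hM, lintegral_const_mul _ (by fun_prop)]
    exact ENNReal.mul_ne_top ENNReal.ofReal_ne_top (lintegral_ball_rpow_norm_ne_top hd hb'd _)
  have hker : ∀ a, 1 ≤ a → ∫⁻ x in Metric.ball (0 : EuclideanSpace ℝ (Fin d)) 1,
      shiftedKernel d a b x ≤ M := by
    intro a ha
    refine lintegral_mono_ae ?_
    have h0 : ∀ᵐ x : EuclideanSpace ℝ (Fin d), x ≠ 0 := by
      simp [ae_iff]
    filter_upwards [ae_restrict_of_ae h0, ae_restrict_mem Metric.isOpen_ball.measurableSet]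
      with x hx hx1
    have hx0 : 0 < ‖x‖ := norm_pos_iff.2 hx
    rw [mem_ball_zero_iff] at hx1
    simp only [shiftedKernel, hx, false_and, if_false]
    rw [← ENNReal.ofReal_mul (by rw [neg_div]; linarith [one_div_neg.2 hb'0])]
    refine ENNReal.ofReal_le_ofReal ?_
    have h1 := antitoneOn_powerTerm_sub hb'b.le ⟨hx0, hx1.le⟩ ⟨one_pos, le_rfl⟩ hx1.le
    simp only at h1
    have h2 : powerTerm a ‖x‖ ≤ 1 := by
      have := monotoneOn_powerTerm a hx0 (Set.mem_Ioi.2 one_pos) hx1.le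
      rw [powerTerm_one_right (by linarith)] at this
      refine this.trans ?_
      rw [div_le_one (by linarith)]; exact ha
    have h3 : powerTerm b' ‖x‖ = ‖x‖ ^ b' / b' := by simp [powerTerm, hb'0.ne]
    have h4 : powerTerm b' 1 = 1 / b' := by simp [powerTerm, hb'0.ne]
    have h5 : -1 / b' * (c * (-b') + ‖x‖ ^ b') = c - ‖x‖ ^ b' / b' := by
      have hne' := hb'0.ne
      field_simp; ring
    rw [h5, hc]
    rw [h3, h4] at h1
    have h6 := one_div_neg.2 hb'0
    linarith [neg_abs_le (powerTerm b 1)]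
  set B := Metric.ball (0 : EuclideanSpace ℝ (Fin d)) (1 / 2) with hB
  have hB0 : (volume B) ≠ 0 := (Metric.measure_ball_pos volume _ (by norm_num)).ne'
  have hBt : (volume B) ≠ ⊤ := measure_ball_lt_top.ne
  have hfin : (volume B)⁻¹ * ((volume B)⁻¹ * (M * volume B)) ≠ ⊤ :=
    ENNReal.mul_ne_top (ENNReal.inv_ne_top.2 hB0) (ENNReal.mul_ne_top (ENNReal.inv_ne_top.2 hB0)
      (ENNReal.mul_ne_top hMt hBt))
  refine ⟨(volume B)⁻¹ • volume.restrict B,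
    ((volume B)⁻¹ * ((volume B)⁻¹ * (M * volume B))).toNNReal,
    ⟨by simp [ENNReal.inv_mul_cancel hB0 hBt]⟩, fun a ha => ?_⟩
  have hm : Measurable (shiftedKernel d a b) :=
    (continuous_shiftedKernel (by linarith)).measurable
  rw [ENNReal.coe_toNNReal hfin, pairEnergy_smul_left, pairEnergy_smul_right hm]
  gcongr
  rw [← setLIntegral_const]
  refine setLIntegral_mono measurable_const fun x hx => ?_
  refine le_trans ?_ (hker a ha)
  calc ∫⁻ y in B, shiftedKernel d a b (x - y)
      ≤ ∫⁻ y, (Metric.ball 0 1).indicator (shiftedKernel d a b) (x - y) := by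
        rw [← lintegral_indicator Metric.isOpen_ball.measurableSet]
        refine lintegral_mono fun y => ?_
        by_cases hy : y ∈ B
        · have : x - y ∈ Metric.ball (0 : EuclideanSpace ℝ (Fin d)) 1 := by
            rw [hB, mem_ball_zero_iff] at hx hy
            rw [mem_ball_zero_iff]
            linarith [norm_sub_le x y]
          rw [Set.indicator_of_mem hy, Set.indicator_of_mem this]
        · rw [Set.indicator_of_notMem hy]; exact zero_le
    _ = ∫⁻ y in Metric.ball 0 1, shiftedKernel d a b y := by
        rw [lintegral_sub_left_eq_self (μ := volume)
          ((Metric.ball 0 1).indicator (shiftedKernel d a b)) x,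
          lintegral_indicator Metric.isOpen_ball.measurableSet]

end shiftedKernel

/-! ### Powers as mixtures of Gaussians. -/

/-- The weight `κ` for which `-r ^ c / c` is, up to constants, the mixture
`κ ∫ t ^ (-c / 2 - 1) exp (-t r ^ 2) dt` of Gaussians. -/
noncomputable def mixtureWeight (c : ℝ) : ℝ := (2 * Real.Gamma (1 - c / 2))⁻¹

theorem mixtureWeight_pos {c : ℝ} (hc : c < 2) : 0 < mixtureWeight c := by
  have := Real.Gamma_pos_of_pos (show 0 < 1 - c / 2 by linarith)
  unfold mixtureWeight; positivity

/-- `Γ` has a pole at `0`, made explicit by `Γ(s + 1) = s Γ(s)`. This is the source of smallness for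
`a` near `2`. -/
theorem tendsto_mixtureWeight : Tendsto mixtureWeight (𝓝[<] 2) (𝓝 0) := by
  have h1 : Tendsto (fun c : ℝ => (1 - c / 2) * (2 * Real.Gamma (1 - c / 2 + 1))⁻¹) (𝓝 2) (𝓝 0) := by
    have hG : ContinuousAt Real.Gamma 1 :=
      (Real.differentiableAt_Gamma fun m => by
        have : (0 : ℝ) ≤ m := m.cast_nonneg
        linarith).continuousAt
    have hlin : Tendsto (fun c : ℝ => 1 - c / 2) (𝓝 2) (𝓝 0) := by
      have : Continuous fun c : ℝ => 1 - c / 2 := by fun_prop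
      simpa using this.tendsto 2
    have hlin' : Tendsto (fun c : ℝ => 1 - c / 2 + 1) (𝓝 2) (𝓝 1) := by
      simpa using hlin.add_const 1
    have h2 := ((hG.tendsto.comp hlin').const_mul 2).inv₀ (by simp [Real.Gamma_one])
    simpa using hlin.mul h2
  refine (h1.mono_left nhdsWithin_le_nhds).congr' ?_
  filter_upwards [self_mem_nhdsWithin] with c hc
  have hc' : 0 < 1 - c / 2 := by have : c < 2 := hc
                                 linarith
  rw [Real.Gamma_add_one hc'.ne', mixtureWeight]
  have hG := Real.Gamma_pos_of_pos hc'
  rw [← mul_assoc, mul_comm 2 (1 - c / 2), mul_assoc, mul_inv, ← mul_assoc,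
    mul_inv_cancel₀ hc'.ne', one_mul]

theorem lintegral_Ioo_ofReal_eq_sub {F f : ℝ → ℝ} {a b : ℝ} (hab : a ≤ b)
    (hF : ContinuousOn F (Set.Icc a b)) (hd : ∀ x ∈ Set.Ioo a b, HasDerivAt F (f x) x)
    (hf : ∀ x ∈ Set.Ioo a b, 0 ≤ f x) :
    ∫⁻ x in Set.Ioo a b, ENNReal.ofReal (f x) = ENNReal.ofReal (F b - F a) := by
  have hi := intervalIntegral.integrableOn_deriv_of_nonneg hF hd hf
  rw [← intervalIntegral.integral_eq_sub_of_hasDerivAt_of_le hab hF hd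
    ((intervalIntegrable_iff_integrableOn_Ioc_of_le hab).2 hi),
    intervalIntegral.integral_of_le hab, integral_Ioc_eq_integral_Ioo,
    ofReal_integral_eq_lintegral_ofReal (hi.mono_set Set.Ioo_subset_Ioc_self)]
  exact (ae_restrict_iff' measurableSet_Ioo).2 (Eventually.of_forall hf)

/-- The Gaussian mixture which represents the difference of `powerTerm c` at `D` and at `r`. -/
noncomputable def radialGap (c D r : ℝ) : ENNReal :=
  ∫⁻ t in Set.Ioi (0 : ℝ), ENNReal.ofReal (mixtureWeight c * t ^ (-c / 2 - 1)
    * (Real.exp (-t * r ^ 2) - Real.exp (-t * D ^ 2)))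

theorem powerTerm_eq_half_powerTerm_sq (c : ℝ) {r : ℝ} (hr : 0 ≤ r) :
    powerTerm c r = 1 / 2 * powerTerm (c / 2) (r ^ 2) := by
  unfold powerTerm
  by_cases hc : c = 0
  · simp [hc]
  · have : c / 2 ≠ 0 := by simpa using hc
    simp only [hc, this, if_false]
    rw [← Real.rpow_natCast, ← Real.rpow_mul hr]
    have : ((2 : ℕ) : ℝ) * (c / 2) = c := by push_cast; ring
    rw [this]; field_simp

theorem lintegral_mixture_exp {c : ℝ} (hc : c < 2) {s : ℝ} (hs : 0 < s) :
    ∫⁻ t in Set.Ioi (0 : ℝ), ENNReal.ofReal (mixtureWeight c * t ^ (-c / 2) * Real.exp (-t * s))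
      = ENNReal.ofReal (1 / 2 * s ^ (c / 2 - 1)) := by
  have ha : 0 < 1 - c / 2 := by linarith
  have hG := Real.Gamma_pos_of_pos ha
  have h1 := Real.integral_rpow_mul_exp_neg_mul_Ioi ha hs
  have h2 : ∀ t : ℝ, mixtureWeight c * t ^ (-c / 2) * Real.exp (-t * s)
      = mixtureWeight c * (t ^ (1 - c / 2 - 1) * Real.exp (-(s * t))) := by
    intro t
    rw [mul_assoc]; congr 3 <;> ring
  simp_rw [h2]
  rw [← ofReal_integral_eq_lintegral_ofReal]
  · rw [integral_const_mul, h1, mixtureWeight]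
    congr 1
    rw [one_div, Real.inv_rpow hs.le, ← Real.rpow_neg hs.le, neg_sub, mul_inv]
    rw [mul_comm _ (Real.Gamma _), mul_assoc, ← mul_assoc _ (Real.Gamma _),
      inv_mul_cancel₀ hG.ne']
    ring
  · refine Integrable.const_mul ?_ _
    refine not_imp_comm.1 integral_undef ?_
    rw [h1]
    positivity
  · refine (ae_restrict_iff' measurableSet_Ioi).2 (Eventually.of_forall fun t ht => ?_)
    have ht' : (0 : ℝ) < t := ht
    have := mixtureWeight_pos hc
    simp only [Pi.zero_apply]
    positivity

/-- The difference of exponentials is an integral in `s = r ^ 2`; Tonelli then leaves a Gamma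
integral in `t`. Subtracting the value at `D` keeps the integrand nonnegative and tames it at `t =
0`, where `t ^ (-c / 2)` is integrable because `c < 2`. -/
theorem radialGap_eq_lintegral {c D r : ℝ} (hc : c < 2) (hr : 0 ≤ r) (hrD : r ≤ D) :
    radialGap c D r = ∫⁻ s in Set.Ioo (r ^ 2) (D ^ 2), ENNReal.ofReal (1 / 2 * s ^ (c / 2 - 1)) := by
  have hκ := mixtureWeight_pos hc
  have hsq : r ^ 2 ≤ D ^ 2 := by gcongr
  calc radialGap c D r = ∫⁻ t in Set.Ioi (0 : ℝ), ∫⁻ s in Set.Ioo (r ^ 2) (D ^ 2),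
        ENNReal.ofReal (mixtureWeight c * t ^ (-c / 2) * Real.exp (-t * s)) := by
        refine setLIntegral_congr_fun measurableSet_Ioi fun t ht => ?_
        have ht' : (0 : ℝ) < t := ht
        rw [lintegral_Ioo_ofReal_eq_sub
          (F := fun s => -(mixtureWeight c * t ^ (-c / 2 - 1)) * Real.exp (-t * s)) hsq
          (by fun_prop)]
        · congr 1; ring
        · intro s _
          have h1 : HasDerivAt (fun s : ℝ => -t * s) (-t) s := by
            simpa using (hasDerivAt_id s).const_mul (-t)
          have h2 := h1.exp.const_mul (-(mixtureWeight c * t ^ (-c / 2 - 1)))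
          refine h2.congr_deriv ?_
          have : t ^ (-c / 2) = t ^ (-c / 2 - 1) * t := by
            rw [← Real.rpow_add_one ht'.ne']; congr 1; ring
          rw [this]; ring
        · intro s _; positivity
    _ = ∫⁻ s in Set.Ioo (r ^ 2) (D ^ 2), ∫⁻ t in Set.Ioi (0 : ℝ),
        ENNReal.ofReal (mixtureWeight c * t ^ (-c / 2) * Real.exp (-t * s)) := by
        refine lintegral_lintegral_swap ?_
        exact Measurable.aemeasurable (by fun_prop)
    _ = _ := by
        refine setLIntegral_congr_fun measurableSet_Ioo fun s hs => ?_
        exact lintegral_mixture_exp hc ((sq_nonneg r).trans_lt hs.1)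

theorem radialGap_eq {c D r : ℝ} (hc : c < 2) (hr : 0 ≤ r) (hrD : r ≤ D)
    (h : 0 < r ∨ 0 < c) : radialGap c D r = ENNReal.ofReal (powerTerm c D - powerTerm c r) := by
  have hsq : r ^ 2 ≤ D ^ 2 := by gcongr
  rw [radialGap_eq_lintegral hc hr hrD, lintegral_Ioo_ofReal_eq_sub
    (F := fun s => 1 / 2 * powerTerm (c / 2) s) hsq,
    ← powerTerm_eq_half_powerTerm_sq c hr, ← powerTerm_eq_half_powerTerm_sq c (hr.trans hrD)]
  · refine ContinuousOn.mul continuousOn_const ?_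
    rcases h with h | h
    · exact (continuousOn_powerTerm _).mono fun s hs =>
        (show 0 < r ^ 2 by positivity).trans_le hs.1
    · exact (continuous_powerTerm (by linarith)).continuousOn
  · intro s hs
    exact (hasDerivAt_powerTerm _ ((sq_nonneg r).trans_lt hs.1)).const_mul _
  · intro s hs
    have : 0 < s := (sq_nonneg r).trans_lt hs.1
    positivity

/-- `s ^ (c / 2 - 1)` is not integrable at `0`. The value matches the singularity of the kernel, so
the decomposition below holds at the origin too. -/
theorem radialGap_zero_right {c D : ℝ} (hc : c ≤ 0) (hD : 0 < D) : radialGap c D 0 = ⊤ := by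
  rw [radialGap_eq_lintegral (by linarith) le_rfl hD.le]
  have hD2 : 0 < D ^ 2 := by positivity
  have hn : ¬ IntegrableOn (fun s : ℝ => 1 / 2 * s ^ (c / 2 - 1)) (Set.Ioo 0 (D ^ 2)) := by
    intro h
    have h2 := h.const_mul 2
    have h3 : IntegrableOn (fun s : ℝ => s ^ (c / 2 - 1)) (Set.Ioo 0 (D ^ 2)) := by
      refine h2.congr (Eventually.of_forall fun s => ?_)
      simp only; ring
    rw [intervalIntegral.integrableOn_Ioo_rpow_iff hD2] at h3
    linarith
  by_contra hne
  refine hn ((lintegral_ofReal_ne_top_iff_integrable ?_ ?_).1 (by simpa using hne))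
  · exact Measurable.aestronglyMeasurable (by fun_prop)
  · refine (ae_restrict_iff' measurableSet_Ioo).2 (Eventually.of_forall fun s hs => ?_)
    have : 0 < s := hs.1
    simp only [Pi.zero_apply]
    positivity

theorem measurable_radialGap (c D : ℝ) : Measurable (radialGap c D) := by
  unfold radialGap
  refine Measurable.lintegral_prod_right' (f := fun p : ℝ × ℝ => ENNReal.ofReal (mixtureWeight c
    * p.2 ^ (-c / 2 - 1) * (Real.exp (-p.2 * p.1 ^ 2) - Real.exp (-p.2 * D ^ 2)))) ?_
  fun_prop

theorem shiftedKernel_add_radialGap {d : ℕ} {a b D : ℝ} (ha : 0 < a) (ha2 : a < 2) (hab : b < a)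
    (hD : 0 < D) {x : EuclideanSpace ℝ (Fin d)} (hx : ‖x‖ ≤ D) :
    shiftedKernel d a b x + radialGap a D ‖x‖ = radialGap b D ‖x‖
      + ENNReal.ofReal (powerTerm a D - powerTerm b D + |powerTerm b 1|) := by
  by_cases h : x = 0 ∧ b ≤ 0
  · obtain ⟨rfl, hb⟩ := h
    simp [shiftedKernel, hb, radialGap_zero_right hb hD]
  · have h' : 0 < ‖x‖ ∨ 0 < b := by
      by_cases h0 : x = 0
      · exact Or.inr (not_le.1 fun hb => h ⟨h0, hb⟩)
      · exact Or.inl (norm_pos_iff.2 h0)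
    have h1 := neg_abs_le_powerTerm_sub ha hab (norm_nonneg x) h'
    have h2 := neg_abs_le_powerTerm_sub ha hab hD.le (Or.inl hD)
    have hmono : ∀ c, (0 < ‖x‖ ∨ 0 < c) → powerTerm c ‖x‖ ≤ powerTerm c D := by
      intro c hc
      rcases (norm_nonneg x).eq_or_lt with h0 | h0
      · rw [← h0] at hc ⊢
        have hc' := hc.resolve_left (lt_irrefl _)
        rw [powerTerm_zero_right hc']
        exact powerTerm_nonneg hc' hD.le
      · exact monotoneOn_powerTerm c h0 (Set.mem_Ioi.2 hD) hx
    have h3 := hmono a (Or.inr ha)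
    have h4 := hmono b h'
    rw [radialGap_eq ha2 (norm_nonneg _) hx (Or.inr ha),
      radialGap_eq (by linarith) (norm_nonneg _) hx h']
    simp only [shiftedKernel, h, if_false]
    rw [← ENNReal.ofReal_add (by linarith) (by linarith),
      ← ENNReal.ofReal_add (by linarith) (by linarith)]
    congr 1; ring

/-! ### Gaussian energies on the Fourier side. -/

/-- The Gaussian whose Fourier transform is `exp (-t ‖x‖ ^ 2)`. -/
noncomputable def fourierGaussian (d : ℕ) (t : ℝ) (ξ : EuclideanSpace ℝ (Fin d)) : ℝ :=
  (4 * Real.pi * t) ^ (-(d : ℝ) / 2) * Real.exp (-(1 / (4 * t)) * ‖ξ‖ ^ 2)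

/-- The mutual energy of two measures for the Gaussian kernel `exp (-t ‖x - y‖ ^ 2)`. -/
noncomputable def gaussPair {d : ℕ} (t : ℝ) (μ ν : Measure (EuclideanSpace ℝ (Fin d))) : ℝ :=
  ∫ z, Real.exp (-t * ‖z.1 - z.2‖ ^ 2) ∂(μ.prod ν)

/-- The energy of the difference of two measures for the Gaussian kernel. -/
noncomputable def gaussDist {d : ℕ} (t : ℝ) (μ ν : Measure (EuclideanSpace ℝ (Fin d))) : ℝ :=
  gaussPair t μ μ + gaussPair t ν ν - 2 * gaussPair t μ ν

section fourierGaussian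

variable {d : ℕ}

theorem fourierGaussian_nonneg {t : ℝ} (ht : 0 < t) (ξ : EuclideanSpace ℝ (Fin d)) :
    0 ≤ fourierGaussian d t ξ := by
  unfold fourierGaussian; positivity

theorem continuous_fourierGaussian (t : ℝ) : Continuous (fourierGaussian d t) := by
  unfold fourierGaussian; fun_prop

theorem integrable_exp_neg_mul_sq_norm {b : ℝ} (hb : 0 < b) :
    Integrable fun ξ : EuclideanSpace ℝ (Fin d) => Real.exp (-b * ‖ξ‖ ^ 2) := by
  refine not_imp_comm.1 integral_undef ?_
  rw [GaussianFourier.integral_rexp_neg_mul_sq_norm hb]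
  positivity

theorem integrable_fourierGaussian {t : ℝ} (ht : 0 < t) : Integrable (fourierGaussian d t) :=
  (integrable_exp_neg_mul_sq_norm (by positivity)).const_mul _

theorem integral_fourierGaussian_mul_cexp {t : ℝ} (ht : 0 < t) (x : EuclideanSpace ℝ (Fin d)) :
    ∫ ξ, (fourierGaussian d t ξ : ℂ) * Complex.exp (inner ℝ x ξ * Complex.I)
      = (Real.exp (-t * ‖x‖ ^ 2) : ℂ) := by
  have hb : 0 < (((1 / (4 * t) : ℝ)) : ℂ).re := by
    rw [Complex.ofReal_re]; positivity
  have h := GaussianFourier.integral_cexp_neg_mul_sq_norm_add hb Complex.I x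
  have h1 : ∀ ξ : EuclideanSpace ℝ (Fin d),
      (fourierGaussian d t ξ : ℂ) * Complex.exp (inner ℝ x ξ * Complex.I)
      = (((4 * Real.pi * t) ^ (-(d : ℝ) / 2) : ℝ) : ℂ)
        * Complex.exp (-((1 / (4 * t) : ℝ) : ℂ) * ‖ξ‖ ^ 2 + Complex.I * inner ℝ x ξ) := by
    intro ξ
    rw [Complex.exp_add, fourierGaussian]
    push_cast
    rw [mul_comm Complex.I]
    ring
  simp_rw [h1]
  rw [integral_const_mul, h, ← mul_assoc]
  have h2 : ((Real.pi : ℂ) / ((1 / (4 * t) : ℝ) : ℂ))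
      ^ ((Module.finrank ℝ (EuclideanSpace ℝ (Fin d)) : ℂ) / 2)
      = (((4 * Real.pi * t) ^ ((d : ℝ) / 2) : ℝ) : ℂ) := by
    rw [Complex.ofReal_cpow (by positivity)]
    congr 1
    · push_cast; field_simp
    · simp
  rw [h2, ← Complex.ofReal_mul, ← Real.rpow_add (by positivity)]
  rw [neg_div, neg_add_cancel, Real.rpow_zero, Complex.ofReal_one, one_mul, Complex.ofReal_exp]
  congr 1
  rw [Complex.I_sq]
  have : (t : ℂ) ≠ 0 := by exact_mod_cast ht.ne'
  push_cast
  field_simp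

theorem gaussPair_eq_integral {t : ℝ} (ht : 0 < t) (μ ν : Measure (EuclideanSpace ℝ (Fin d)))
    [IsProbabilityMeasure μ] [IsProbabilityMeasure ν] :
    (gaussPair t μ ν : ℂ) = ∫ ξ, (fourierGaussian d t ξ : ℂ)
      * (charFun μ ξ * (starRingEnd ℂ) (charFun ν ξ)) := by
  have hprod : ∀ ξ, charFun μ ξ * (starRingEnd ℂ) (charFun ν ξ)
      = ∫ z, Complex.exp (inner ℝ (z.1 - z.2) ξ * Complex.I) ∂(μ.prod ν) := by
    intro ξ
    rw [← charFun_neg, charFun_apply, charFun_apply, ← integral_prod_mul]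
    refine integral_congr_ae (Eventually.of_forall fun z => ?_)
    simp only [inner_neg_right, inner_sub_left]
    rw [← Complex.exp_add]
    congr 1
    push_cast; ring
  simp_rw [hprod, ← integral_const_mul]
  rw [integral_integral_swap]
  · simp_rw [integral_fourierGaussian_mul_cexp ht]
    rw [gaussPair, ← integral_complex_ofReal]
  · refine Integrable.mono' (((integrable_fourierGaussian ht).comp_fst (μ.prod ν))) ?_ ?_
    · have := continuous_fourierGaussian (d := d) t
      exact Continuous.aestronglyMeasurable (by fun_prop)
    · refine Eventually.of_forall fun p => ?_
      simp only [Function.uncurry, norm_mul, Complex.norm_real, Complex.norm_exp_ofReal_mul_I,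
        mul_one, Real.norm_eq_abs, abs_of_nonneg (fourierGaussian_nonneg ht _), le_refl]

theorem integrable_mul_bounded {f : EuclideanSpace ℝ (Fin d) → ℝ} (hf : Integrable f)
    {g : EuclideanSpace ℝ (Fin d) → ℝ} (hg : Measurable g) {C : ℝ} (hC : ∀ x, ‖g x‖ ≤ C) :
    Integrable fun x => f x * g x :=
  hf.mul_bdd hg.aestronglyMeasurable (Eventually.of_forall hC)

theorem norm_charFun_sub_le (μ ν : Measure (EuclideanSpace ℝ (Fin d)))
    [IsProbabilityMeasure μ] [IsProbabilityMeasure ν] (ξ : EuclideanSpace ℝ (Fin d)) :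
    ‖charFun μ ξ - charFun ν ξ‖ ≤ 2 :=
  (norm_sub_le _ _).trans (by
    linarith [norm_charFun_le_one (μ := μ) ξ, norm_charFun_le_one (μ := ν) ξ])

theorem measurable_norm_charFun_sub_sq (μ ν : Measure (EuclideanSpace ℝ (Fin d)))
    [IsProbabilityMeasure μ] [IsProbabilityMeasure ν] :
    Measurable fun ξ => ‖charFun μ ξ - charFun ν ξ‖ ^ 2 :=
  ((measurable_charFun.sub measurable_charFun).norm).pow_const 2

theorem norm_charFun_sub_sq_le (μ ν : Measure (EuclideanSpace ℝ (Fin d)))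
    [IsProbabilityMeasure μ] [IsProbabilityMeasure ν] (ξ : EuclideanSpace ℝ (Fin d)) :
    ‖‖charFun μ ξ - charFun ν ξ‖ ^ 2‖ ≤ 4 := by
  rw [Real.norm_eq_abs, abs_of_nonneg (by positivity)]
  nlinarith [norm_charFun_sub_le μ ν ξ, norm_nonneg (charFun μ ξ - charFun ν ξ)]

/-- Expanding `|φ_μ - φ_ν| ^ 2` turns the three mutual energies into one integral with positive
weight: Gaussian kernels are positive definite. -/
theorem gaussDist_eq_integral {t : ℝ} (ht : 0 < t) (μ ν : Measure (EuclideanSpace ℝ (Fin d)))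
    [IsProbabilityMeasure μ] [IsProbabilityMeasure ν] :
    gaussDist t μ ν = ∫ ξ, fourierGaussian d t ξ * ‖charFun μ ξ - charFun ν ξ‖ ^ 2 := by
  have hm : ∀ (μ ν : Measure (EuclideanSpace ℝ (Fin d))) [IsProbabilityMeasure μ]
      [IsProbabilityMeasure ν],
      Measurable fun ξ => charFun μ ξ * (starRingEnd ℂ) (charFun ν ξ) := fun μ ν _ _ =>
    measurable_charFun.mul (Complex.continuous_conj.measurable.comp measurable_charFun)
  have hb : ∀ (μ ν : Measure (EuclideanSpace ℝ (Fin d))) [IsProbabilityMeasure μ]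
      [IsProbabilityMeasure ν], ∀ ξ, ‖charFun μ ξ * (starRingEnd ℂ) (charFun ν ξ)‖ ≤ 1 := by
    intro μ ν _ _ ξ
    rw [norm_mul, RCLike.norm_conj]
    exact mul_le_one₀ (norm_charFun_le_one ξ) (norm_nonneg _) (norm_charFun_le_one ξ)
  have hi : ∀ (μ ν : Measure (EuclideanSpace ℝ (Fin d))) [IsProbabilityMeasure μ]
      [IsProbabilityMeasure ν], Integrable fun ξ => fourierGaussian d t ξ
        * (charFun μ ξ * (starRingEnd ℂ) (charFun ν ξ)).re := by
    intro μ ν _ _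
    exact integrable_mul_bounded (integrable_fourierGaussian ht)
      (Complex.measurable_re.comp (hm μ ν))
      fun ξ => (Complex.abs_re_le_norm _).trans (hb μ ν ξ)
  have hp : ∀ (μ ν : Measure (EuclideanSpace ℝ (Fin d))) [IsProbabilityMeasure μ]
      [IsProbabilityMeasure ν], gaussPair t μ ν = ∫ ξ, fourierGaussian d t ξ
        * (charFun μ ξ * (starRingEnd ℂ) (charFun ν ξ)).re := by
    intro μ ν _ _
    have h1 := congrArg Complex.re (gaussPair_eq_integral ht μ ν)
    rw [Complex.ofReal_re] at h1
    rw [h1]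
    have h2 : Integrable fun ξ => (fourierGaussian d t ξ : ℂ)
        * (charFun μ ξ * (starRingEnd ℂ) (charFun ν ξ)) :=
      (integrable_fourierGaussian ht).ofReal.mul_bdd (hm μ ν).aestronglyMeasurable
        (Eventually.of_forall (hb μ ν))
    have h3 := integral_re h2
    simp only [RCLike.re_to_complex] at h3
    rw [← h3]
    refine integral_congr_ae (Eventually.of_forall fun ξ => ?_)
    simp only [Complex.re_ofReal_mul]
  rw [gaussDist, hp μ μ, hp ν ν, hp μ ν, ← integral_const_mul, ← integral_add (hi _ _) (hi _ _)]
  refine (integral_sub ((hi μ μ).add (hi ν ν)) ((hi μ ν).const_mul 2)).symm.trans ?_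
  refine integral_congr_ae (Eventually.of_forall fun ξ => ?_)
  simp only [Pi.add_apply]
  rw [← Complex.normSq_eq_norm_sq, Complex.normSq_sub, Complex.mul_conj, Complex.mul_conj]
  simp only [Complex.ofReal_re]
  ring

theorem gaussDist_nonneg {t : ℝ} (ht : 0 < t) (μ ν : Measure (EuclideanSpace ℝ (Fin d)))
    [IsProbabilityMeasure μ] [IsProbabilityMeasure ν] : 0 ≤ gaussDist t μ ν := by
  rw [gaussDist_eq_integral ht]
  exact integral_nonneg fun ξ => mul_nonneg (fourierGaussian_nonneg ht _) (by positivity)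

end fourierGaussian

/-! ### Duality between Schwartz functions and the negative Sobolev norm. -/

/-- A weighted `L²` norm (squared) of the difference of the characteristic functions of two
measures. It is the squared norm of their difference in a Sobolev space of negative order. -/
noncomputable def sobolevDist {d : ℕ} (μ ν : Measure (EuclideanSpace ℝ (Fin d))) : ℝ :=
  ∫ η, ((1 + ‖η‖ ^ 2) ^ (d + 1))⁻¹ * ‖charFun μ η - charFun ν η‖ ^ 2

section sobolevDist

variable {d : ℕ}

theorem integrable_inv_one_add_norm_sq_pow :
    Integrable fun η : EuclideanSpace ℝ (Fin d) => ((1 + ‖η‖ ^ 2) ^ (d + 1))⁻¹ := by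
  have h := integrable_rpow_neg_one_add_norm_sq (E := EuclideanSpace ℝ (Fin d)) (μ := volume)
    (r := 2 * (d + 1)) (by simp; linarith [(Nat.cast_nonneg d : (0 : ℝ) ≤ d)])
  refine h.congr (Eventually.of_forall fun η => ?_)
  simp only
  rw [← Real.rpow_natCast _ (d + 1), ← Real.rpow_neg (by positivity)]
  congr 1
  push_cast; ring

theorem integrable_sobolevDist (μ ν : Measure (EuclideanSpace ℝ (Fin d)))
    [IsProbabilityMeasure μ] [IsProbabilityMeasure ν] :
    Integrable fun η => ((1 + ‖η‖ ^ 2) ^ (d + 1))⁻¹ * ‖charFun μ η - charFun ν η‖ ^ 2 :=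
  integrable_mul_bounded integrable_inv_one_add_norm_sq_pow
    (measurable_norm_charFun_sub_sq μ ν) (norm_charFun_sub_sq_le μ ν)

theorem sobolevDist_nonneg (μ ν : Measure (EuclideanSpace ℝ (Fin d))) :
    0 ≤ sobolevDist μ ν :=
  integral_nonneg fun η => by positivity

theorem integrable_weight_mul_schwartz_sq (f : 𝓢(EuclideanSpace ℝ (Fin d), ℂ)) :
    Integrable fun η => (1 + ‖η‖ ^ 2) ^ (d + 1) * ‖f η‖ ^ 2 := by
  set C := 2 ^ (2 * (d + 1)) * (Finset.Iic (2 * (d + 1), 0)).sup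
    (fun m => SchwartzMap.seminorm ℝ m.1 m.2) f with hC
  have hle : ∀ η, (1 + ‖η‖ ^ 2) ^ (d + 1) * ‖f η‖ ≤ C := by
    intro η
    have h := SchwartzMap.one_add_le_sup_seminorm_apply (𝕜 := ℝ) (m := (2 * (d + 1), 0))
      (k := 2 * (d + 1)) (n := 0) le_rfl le_rfl f η
    rw [norm_iteratedFDeriv_zero] at h
    refine le_trans ?_ h
    gcongr
    rw [pow_mul]
    gcongr
    nlinarith [norm_nonneg η]
  refine (f.integrable.norm.const_mul C).mono' ?_ (Eventually.of_forall fun η => ?_)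
  · have := f.continuous
    exact Continuous.aestronglyMeasurable (by fun_prop)
  · rw [Real.norm_eq_abs, abs_of_nonneg (by positivity), sq ‖f η‖, ← mul_assoc]
    exact mul_le_mul_of_nonneg_right (hle η) (norm_nonneg _)

/-- Fourier inversion of `g` and Fubini. The dilation by `2π` reconciles the normalization of `𝓕`
with that of `charFun`. -/
theorem integral_schwartz_mul_cexp (g : 𝓢(EuclideanSpace ℝ (Fin d), ℂ))
    (μ : Measure (EuclideanSpace ℝ (Fin d))) [IsProbabilityMeasure μ]
    (ζ : EuclideanSpace ℝ (Fin d)) :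
    ∫ x, g x * Complex.exp (inner ℝ x ζ * Complex.I) ∂μ
      = ∫ η, (𝓕 g) η * charFun μ ((2 * Real.pi) • η + ζ) := by
  have hinv : ∀ x, g x = ∫ η, Complex.exp (↑(2 * Real.pi * inner ℝ η x) * Complex.I)
      * (𝓕 g) η := by
    intro x
    have h1 : 𝓕⁻ (𝓕 (g : EuclideanSpace ℝ (Fin d) → ℂ)) = g :=
      g.continuous.fourierInv_fourier_eq g.integrable (𝓕 g).integrable
    conv_lhs => rw [← h1]
    rw [Real.fourierInv_eq']
    rfl
  have h2 : ∀ x, g x * Complex.exp (inner ℝ x ζ * Complex.I)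
      = ∫ η, (𝓕 g) η * Complex.exp (inner ℝ x ((2 * Real.pi) • η + ζ) * Complex.I) := by
    intro x
    rw [hinv x, ← integral_mul_const]
    refine integral_congr_ae (Eventually.of_forall fun η => ?_)
    simp only
    have he : Complex.exp (inner ℝ x ((2 * Real.pi) • η + ζ) * Complex.I)
        = Complex.exp (↑(2 * Real.pi * inner ℝ η x) * Complex.I)
          * Complex.exp (inner ℝ x ζ * Complex.I) := by
      rw [← Complex.exp_add, inner_add_right, inner_smul_right, real_inner_comm η x]
      congr 1
      push_cast; ring
    rw [he]; ring
  simp_rw [h2]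
  rw [integral_integral_swap]
  · refine integral_congr_ae (Eventually.of_forall fun η => ?_)
    simp only
    rw [integral_const_mul, charFun_apply]
  · refine Integrable.mono' (((𝓕 g).integrable.norm).comp_snd μ) ?_
      (Eventually.of_forall fun p => ?_)
    · have := (𝓕 g).continuous
      exact Continuous.aestronglyMeasurable (by fun_prop)
    · simp only [Function.uncurry, norm_mul, Complex.norm_exp_ofReal_mul_I, mul_one, le_refl]

/-- Change of variables; the Jacobian factor `(2π) ^ (-d)` is at most `1`. -/
theorem integral_sobolev_comp_le (μ ν : Measure (EuclideanSpace ℝ (Fin d)))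
    [IsProbabilityMeasure μ] [IsProbabilityMeasure ν] (ζ : EuclideanSpace ℝ (Fin d)) :
    Integrable (fun η => ((1 + ‖(2 * Real.pi) • η + ζ‖ ^ 2) ^ (d + 1))⁻¹
      * ‖charFun μ ((2 * Real.pi) • η + ζ) - charFun ν ((2 * Real.pi) • η + ζ)‖ ^ 2) ∧
    ∫ η, ((1 + ‖(2 * Real.pi) • η + ζ‖ ^ 2) ^ (d + 1))⁻¹
      * ‖charFun μ ((2 * Real.pi) • η + ζ) - charFun ν ((2 * Real.pi) • η + ζ)‖ ^ 2
      ≤ sobolevDist μ ν := by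
  set F : EuclideanSpace ℝ (Fin d) → ℝ := fun η =>
    ((1 + ‖η‖ ^ 2) ^ (d + 1))⁻¹ * ‖charFun μ η - charFun ν η‖ ^ 2 with hF
  have hFi : Integrable F := integrable_sobolevDist μ ν
  have hGi : Integrable fun y => F (y + ζ) := hFi.comp_add_right ζ
  have hpi : (1 : ℝ) ≤ 2 * Real.pi := by linarith [Real.pi_gt_three]
  refine ⟨hGi.comp_smul (show 2 * Real.pi ≠ 0 by positivity), ?_⟩
  have h1 := Measure.integral_comp_smul_of_nonneg (volume : Measure (EuclideanSpace ℝ (Fin d)))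
    (fun y => F (y + ζ)) (2 * Real.pi) (hR := by linarith)
  refine h1.trans_le ?_
  rw [integral_add_right_eq_self F ζ, smul_eq_mul]
  change _ * sobolevDist μ ν ≤ _
  refine mul_le_of_le_one_left (sobolevDist_nonneg μ ν) (inv_le_one_of_one_le₀ ?_)
  exact one_le_pow₀ hpi

/-- Take `l = T / A`. This turns a family of pointwise Young inequalities into Cauchy–Schwarz. -/
theorem sq_le_mul_of_forall_two_mul_le {T A B : ℝ} (hT : 0 ≤ T) (hA : 0 < A) (hB : 0 ≤ B)
    (h : ∀ l, 0 < l → 2 * T ≤ l * A + l⁻¹ * B) : T ^ 2 ≤ A * B := by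
  rcases hT.eq_or_lt with h0 | h0
  · rw [← h0]; simpa using mul_nonneg hA.le hB
  · have h1 := h (T / A) (by positivity)
    rw [div_mul_cancel₀ _ hA.ne', inv_div] at h1
    have h2 : T ≤ A / T * B := by linarith
    rw [div_mul_eq_mul_div, le_div_iff₀ h0] at h2
    nlinarith

/-- Peetre's inequality: shifting the frequency by `ζ` costs only a polynomial factor in `ζ`. -/
theorem one_add_norm_smul_add_sq_le (η ζ : EuclideanSpace ℝ (Fin d)) :
    1 + ‖(2 * Real.pi) • η + ζ‖ ^ 2 ≤ 8 * Real.pi ^ 2 * (1 + ‖ζ‖ ^ 2) * (1 + ‖η‖ ^ 2) := by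
  have h1 : ‖(2 * Real.pi) • η + ζ‖ ≤ 2 * Real.pi * ‖η‖ + ‖ζ‖ := by
    refine (norm_add_le _ _).trans_eq ?_
    rw [norm_smul, Real.norm_eq_abs, abs_of_pos (by positivity)]
  have h2 : ‖(2 * Real.pi) • η + ζ‖ ^ 2 ≤ (2 * Real.pi * ‖η‖ + ‖ζ‖) ^ 2 := by gcongr
  have h3 := Real.pi_gt_three
  have h4 : 9 < Real.pi ^ 2 := by nlinarith
  have h5 : 0 ≤ (Real.pi ^ 2 - 9) * ‖ζ‖ ^ 2 := mul_nonneg (by linarith) (by positivity)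
  have h6 : 0 ≤ Real.pi ^ 2 * ‖ζ‖ ^ 2 * ‖η‖ ^ 2 := by positivity
  nlinarith [sq_nonneg (2 * Real.pi * ‖η‖ - ‖ζ‖), sq_nonneg ‖ζ‖]

theorem two_mul_mul_le_weighted (u v : ℝ) {l W : ℝ} (hl : 0 < l) (hW : 0 < W) :
    2 * (u * v) ≤ l * (W * u ^ 2) + l⁻¹ * (W⁻¹ * v ^ 2) := by
  have h7 : 2 * (u * v) * (l * W) ≤ (l * W * u) ^ 2 + v ^ 2 := by
    nlinarith [sq_nonneg (l * W * u - v)]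
  rw [← le_div_iff₀ (by positivity)] at h7
  refine h7.trans_eq ?_
  field_simp

/-- Weighted Cauchy–Schwarz: the decay of `G` absorbs the inverse Sobolev weight, and Peetre's
inequality accounts for the shift. -/
theorem exists_norm_integral_mul_charFun_sq_le (G : 𝓢(EuclideanSpace ℝ (Fin d), ℂ)) :
    ∃ C : ℝ, 0 < C ∧ ∀ (μ ν : Measure (EuclideanSpace ℝ (Fin d))) [IsProbabilityMeasure μ]
      [IsProbabilityMeasure ν] (ζ : EuclideanSpace ℝ (Fin d)),
      ‖(∫ η, G η * charFun μ ((2 * Real.pi) • η + ζ))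
        - ∫ η, G η * charFun ν ((2 * Real.pi) • η + ζ)‖ ^ 2
        ≤ C * (1 + ‖ζ‖ ^ 2) ^ (d + 1) * sobolevDist μ ν := by
  set S := ∫ η, (1 + ‖η‖ ^ 2) ^ (d + 1) * ‖G η‖ ^ 2 with hS
  have hS0 : 0 ≤ S := integral_nonneg fun η => by positivity
  have hSi := integrable_weight_mul_schwartz_sq G
  have hK0 : 0 < (8 * Real.pi ^ 2) ^ (d + 1) := by positivity
  refine ⟨(8 * Real.pi ^ 2) ^ (d + 1) * (S + 1), by positivity, fun μ ν _ _ ζ => ?_⟩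
  have hK : ∀ η : EuclideanSpace ℝ (Fin d), (1 + ‖(2 * Real.pi) • η + ζ‖ ^ 2) ^ (d + 1)
      ≤ (8 * Real.pi ^ 2) ^ (d + 1) * (1 + ‖ζ‖ ^ 2) ^ (d + 1) * (1 + ‖η‖ ^ 2) ^ (d + 1) := by
    intro η
    rw [← mul_pow, ← mul_pow]
    exact pow_le_pow_left₀ (by positivity) (one_add_norm_smul_add_sq_le η ζ) _
  obtain ⟨hi, hle⟩ := integral_sobolev_comp_le μ ν ζ
  have hint : ∀ (μ : Measure (EuclideanSpace ℝ (Fin d))) [IsProbabilityMeasure μ],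
      Integrable fun η => G η * charFun μ ((2 * Real.pi) • η + ζ) := fun μ _ =>
    G.integrable.mul_bdd (c := 1)
      (measurable_charFun.comp (by fun_prop)).aestronglyMeasurable
      (Eventually.of_forall fun η => norm_charFun_le_one _)
  have hZ0 : 0 < (1 + ‖ζ‖ ^ 2) ^ (d + 1) := by positivity
  generalize (8 * Real.pi ^ 2) ^ (d + 1) = K at *
  generalize (1 + ‖ζ‖ ^ 2) ^ (d + 1) = Z at *
  refine sq_le_mul_of_forall_two_mul_le (norm_nonneg _) (by positivity)
    (sobolevDist_nonneg μ ν) fun l hl => ?_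
  rw [← integral_sub (hint μ) (hint ν)]
  have hpt : ∀ η, 2 * ‖G η * charFun μ ((2 * Real.pi) • η + ζ)
      - G η * charFun ν ((2 * Real.pi) • η + ζ)‖
      ≤ l * (K * Z * ((1 + ‖η‖ ^ 2) ^ (d + 1) * ‖G η‖ ^ 2))
        + l⁻¹ * (((1 + ‖(2 * Real.pi) • η + ζ‖ ^ 2) ^ (d + 1))⁻¹
          * ‖charFun μ ((2 * Real.pi) • η + ζ) - charFun ν ((2 * Real.pi) • η + ζ)‖ ^ 2) := by
    intro η
    rw [← mul_sub, norm_mul]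
    refine (two_mul_mul_le_weighted _ _ hl
      (W := (1 + ‖(2 * Real.pi) • η + ζ‖ ^ 2) ^ (d + 1)) (by positivity)).trans ?_
    refine add_le_add (mul_le_mul_of_nonneg_left ?_ hl.le) le_rfl
    rw [← mul_assoc]
    exact mul_le_mul_of_nonneg_right (hK η) (by positivity)
  have h1 := integral_mono (((hint μ).sub (hint ν)).norm.const_mul 2)
    (((hSi.const_mul (K * Z)).const_mul l).add (hi.const_mul l⁻¹)) hpt
  have h2 := norm_integral_le_integral_norm (μ := volume)
    (fun η => G η * charFun μ ((2 * Real.pi) • η + ζ) - G η * charFun ν ((2 * Real.pi) • η + ζ))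
  have h3 : l⁻¹ * _ ≤ l⁻¹ * _ := mul_le_mul_of_nonneg_left hle (inv_nonneg.2 hl.le)
  have h4 : 0 ≤ l * (K * Z) := by positivity
  rw [integral_const_mul, integral_add' ((hSi.const_mul (K * Z)).const_mul l)
    (hi.const_mul l⁻¹), integral_const_mul, integral_const_mul, integral_const_mul, ← hS] at h1
  simp only [Pi.sub_apply] at h1
  nlinarith

theorem exists_norm_schwartz_pairing_sq_le (g : 𝓢(EuclideanSpace ℝ (Fin d), ℂ)) :
    ∃ C : ℝ, 0 < C ∧ ∀ (μ ν : Measure (EuclideanSpace ℝ (Fin d))) [IsProbabilityMeasure μ]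
      [IsProbabilityMeasure ν] (ζ : EuclideanSpace ℝ (Fin d)),
      ‖∫ x, g x * Complex.exp (inner ℝ x ζ * Complex.I) ∂μ
        - ∫ x, g x * Complex.exp (inner ℝ x ζ * Complex.I) ∂ν‖ ^ 2
        ≤ C * (1 + ‖ζ‖ ^ 2) ^ (d + 1) * sobolevDist μ ν := by
  obtain ⟨C, hC, h⟩ := exists_norm_integral_mul_charFun_sq_le (𝓕 g)
  refine ⟨C, hC, fun μ ν _ _ ζ => ?_⟩
  rw [integral_schwartz_mul_cexp, integral_schwartz_mul_cexp]
  exact h μ ν ζ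

end sobolevDist

/-! ### Low frequencies of differences of centred measures. -/

theorem cexp_mul_I_eq_taylor (z : ℝ) :
    Complex.exp (z * Complex.I) = 1 + z * Complex.I
      - z ^ 2 * ∫ s in (0 : ℝ)..1, (1 - (s : ℂ)) * Complex.exp (s * z * Complex.I) := by
  have hd : ∀ s : ℝ, HasDerivAt (fun s : ℝ => ((1 - (s : ℂ)) * (z * Complex.I) + 1)
      * Complex.exp (s * z * Complex.I))
      (-(z : ℂ) ^ 2 * -((1 - (s : ℂ)) * Complex.exp (s * z * Complex.I)) * -1) s := by
    intro s
    have h0 : HasDerivAt (fun s : ℝ => (s : ℂ)) 1 s := Complex.ofRealCLM.hasDerivAt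
    have h1 : HasDerivAt (fun s : ℝ => (1 - (s : ℂ)) * (z * Complex.I) + 1)
        (-1 * (z * Complex.I)) s := ((h0.const_sub 1).mul_const _).add_const 1
    have h2 : HasDerivAt (fun s : ℝ => Complex.exp (s * z * Complex.I))
        (Complex.exp (s * z * Complex.I) * (1 * z * Complex.I)) s :=
      ((h0.mul_const (z : ℂ)).mul_const Complex.I).cexp
    refine (h1.mul h2).congr_deriv ?_
    linear_combination (1 - (s : ℂ)) * (z : ℂ) ^ 2 * Complex.exp (s * z * Complex.I) * Complex.I_sq
  have hi := intervalIntegral.integral_eq_sub_of_hasDerivAt (a := 0) (b := 1) (fun s _ => hd s)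
    (Continuous.intervalIntegrable (by fun_prop) _ _)
  have h2 : ∫ s in (0 : ℝ)..1, (-(z : ℂ) ^ 2 * -((1 - (s : ℂ)) * Complex.exp (s * z * Complex.I)) * -1)
      = -(z : ℂ) ^ 2 * ∫ s in (0 : ℝ)..1, (1 - (s : ℂ)) * Complex.exp (s * z * Complex.I) := by
    rw [← intervalIntegral.integral_const_mul]
    congr 1; funext s; ring
  rw [h2] at hi
  have h3 : ∀ w : ℂ, -(z : ℂ) ^ 2 * w = Complex.exp (z * Complex.I) - (z * Complex.I + 1)
      → Complex.exp (z * Complex.I) = 1 + z * Complex.I - z ^ 2 * w := by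
    intro w hw; linear_combination -hw
  refine h3 _ (hi.trans ?_)
  simp

theorem exists_schwartz_eq_coord_mul_coord {d : ℕ} {R : ℝ} (hR : 0 ≤ R) (i j : Fin d) :
    ∃ g : 𝓢(EuclideanSpace ℝ (Fin d), ℂ), ∀ x, ‖x‖ ≤ R → g x = (x i : ℂ) * (x j : ℂ) := by
  let χ : ContDiffBump (0 : EuclideanSpace ℝ (Fin d)) := ⟨R + 1, R + 2, by linarith, by linarith⟩
  have hc : HasCompactSupport fun x : EuclideanSpace ℝ (Fin d) =>
      ((χ x * (x i * x j) : ℝ) : ℂ) := by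
    have h1 : HasCompactSupport fun x : EuclideanSpace ℝ (Fin d) => χ x * (x i * x j) :=
      χ.hasCompactSupport.mul_right
    exact h1.comp_left (g := fun r : ℝ => (r : ℂ)) (by simp)
  have hs : ContDiff ℝ ∞ fun x : EuclideanSpace ℝ (Fin d) => ((χ x * (x i * x j) : ℝ) : ℂ) := by
    have h1 : ContDiff ℝ ∞ χ := χ.contDiff
    have h2 : ContDiff ℝ ∞ fun x : EuclideanSpace ℝ (Fin d) => x i * x j := by fun_prop
    exact Complex.ofRealCLM.contDiff.comp (h1.mul h2)
  refine ⟨hc.toSchwartzMap hs, fun x hx => ?_⟩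
  have h1 : χ x = 1 := χ.one_of_mem_closedBall (by
    rw [mem_closedBall_zero_iff]
    exact hx.trans (by change R ≤ R + 1; linarith))
  change ((χ x * (x i * x j) : ℝ) : ℂ) = _
  rw [h1]; push_cast; ring

/-- The first-order Taylor term vanishes by centring. On the support the quadratic coefficients `x i
* x j` may be replaced by Schwartz functions, so the remainder consists of Schwartz pairings at the
frequencies `s • ξ`. -/
theorem charFun_eq_taylor {d : ℕ} {R : ℝ} {g : Fin d → Fin d → 𝓢(EuclideanSpace ℝ (Fin d), ℂ)}
    (hg : ∀ i j x, ‖x‖ ≤ R → g i j x = (x i : ℂ) * (x j : ℂ))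
    (μ : Measure (EuclideanSpace ℝ (Fin d))) [IsProbabilityMeasure μ]
    (hR : ∀ᵐ x ∂μ, ‖x‖ ≤ R) (hm : ∫ x, x ∂μ = 0) (ξ : EuclideanSpace ℝ (Fin d)) :
    (∀ i j, IntervalIntegrable (fun s : ℝ => (1 - (s : ℂ))
        * ∫ x, g i j x * Complex.exp (inner ℝ x (s • ξ) * Complex.I) ∂μ) volume 0 1) ∧
    charFun μ ξ = 1 - ∑ i, ∑ j, (ξ i : ℂ) * (ξ j : ℂ) * ∫ s in (0 : ℝ)..1, (1 - (s : ℂ))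
        * ∫ x, g i j x * Complex.exp (inner ℝ x (s • ξ) * Complex.I) ∂μ := by
  have hint : ∀ i j, Integrable (Function.uncurry fun (x : EuclideanSpace ℝ (Fin d)) (s : ℝ) =>
      (1 - (s : ℂ)) * (g i j x * Complex.exp (inner ℝ x (s • ξ) * Complex.I)))
      (μ.prod (volume.restrict (Set.Ioc 0 1))) := by
    intro i j
    obtain ⟨C, hC0, hC⟩ := (g i j).decay 0 0
    have hc := (g i j).continuous
    refine Integrable.mono' (integrable_const C)
      (Continuous.aestronglyMeasurable (by fun_prop)) ?_
    have hs : ∀ᵐ p : EuclideanSpace ℝ (Fin d) × ℝ ∂(μ.prod (volume.restrict (Set.Ioc 0 1))),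
        p.2 ∈ Set.Ioc (0 : ℝ) 1 :=
      Measure.quasiMeasurePreserving_snd.ae (ae_restrict_mem measurableSet_Ioc)
    filter_upwards [hs] with p hp
    simp only [Function.uncurry, norm_mul, Complex.norm_exp_ofReal_mul_I, mul_one]
    have h1 : ‖1 - (p.2 : ℂ)‖ ≤ 1 := by
      rw [← Complex.ofReal_one, ← Complex.ofReal_sub, Complex.norm_real, Real.norm_eq_abs, abs_le]
      constructor <;> linarith [hp.1, hp.2]
    have h2 := hC p.1
    rw [pow_zero, one_mul, norm_iteratedFDeriv_zero] at h2
    exact (mul_le_of_le_one_left (norm_nonneg _) h1).trans h2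
  refine ⟨fun i j => ?_, ?_⟩
  · rw [intervalIntegrable_iff_integrableOn_Ioc_of_le zero_le_one]
    refine (hint i j).integral_prod_right.congr (Eventually.of_forall fun s => ?_)
    simp only [Function.uncurry]
    rw [integral_const_mul]
  · have hpt : ∀ᵐ x ∂μ, Complex.exp (inner ℝ x ξ * Complex.I) = 1 + inner ℝ x ξ * Complex.I
        - ∑ i, ∑ j, (ξ i : ℂ) * (ξ j : ℂ) * ∫ s in Set.Ioc (0 : ℝ) 1, (1 - (s : ℂ))
          * (g i j x * Complex.exp (inner ℝ x (s • ξ) * Complex.I)) := by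
      filter_upwards [hR] with x hx
      rw [cexp_mul_I_eq_taylor]
      congr 1
      have h1 : ∀ i j, ∫ s in Set.Ioc (0 : ℝ) 1, (1 - (s : ℂ))
          * (g i j x * Complex.exp (inner ℝ x (s • ξ) * Complex.I))
          = (x i : ℂ) * (x j : ℂ) * ∫ s in (0 : ℝ)..1, (1 - (s : ℂ))
            * Complex.exp (s * (inner ℝ x ξ : ℝ) * Complex.I) := by
        intro i j
        rw [intervalIntegral.integral_of_le zero_le_one, ← integral_const_mul]
        refine integral_congr_ae (Eventually.of_forall fun s => ?_)
        simp only
        rw [hg i j x hx, inner_smul_right]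
        push_cast; ring
      simp_rw [h1]
      generalize (∫ s in (0 : ℝ)..1, (1 - (s : ℂ))
            * Complex.exp (s * (inner ℝ x ξ : ℝ) * Complex.I)) = J
      have h2 : ((inner ℝ x ξ : ℝ) : ℂ) = ∑ i, (ξ i : ℂ) * (x i : ℂ) := by
        rw [PiLp.inner_apply]
        push_cast
        simp
      rw [h2, sq, Finset.sum_mul_sum, Finset.sum_mul]
      refine Finset.sum_congr rfl fun i _ => ?_
      rw [Finset.sum_mul]
      refine Finset.sum_congr rfl fun j _ => ?_
      ring
    have hx : Integrable (fun x => x) μ :=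
      Integrable.mono' (integrable_const R) aestronglyMeasurable_id hR
    have hin : Integrable (fun x => ((inner ℝ x ξ : ℝ) : ℂ) * Complex.I) μ :=
      (hx.inner_const ξ).ofReal.mul_const _
    have hI : ∀ i j, Integrable (fun x => (ξ i : ℂ) * (ξ j : ℂ) * ∫ s in Set.Ioc (0 : ℝ) 1,
        (1 - (s : ℂ)) * (g i j x * Complex.exp (inner ℝ x (s • ξ) * Complex.I))) μ :=
      fun i j => ((hint i j).integral_prod_left).const_mul _
    have hin0 : ∫ x, ((inner ℝ x ξ : ℝ) : ℂ) * Complex.I ∂μ = 0 := by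
      rw [integral_mul_const, integral_complex_ofReal]
      have : ∫ x, inner ℝ x ξ ∂μ = 0 := by
        simp_rw [real_inner_comm ξ]
        rw [integral_inner hx, hm, inner_zero_right]
      rw [this]; simp
    have hlin : Integrable (fun x => 1 + ((inner ℝ x ξ : ℝ) : ℂ) * Complex.I) μ :=
      (integrable_const 1).add hin
    rw [charFun_apply, integral_congr_ae hpt, integral_sub hlin
      (integrable_finsetSum _ fun i _ => integrable_finsetSum _ fun j _ => hI i j),
      integral_add (integrable_const _) hin, hin0,
      integral_finsetSum _ fun i _ => integrable_finsetSum _ fun j _ => hI i j]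
    simp only [integral_const, probReal_univ, one_smul, add_zero]
    congr 1
    refine Finset.sum_congr rfl fun i _ => ?_
    rw [integral_finsetSum _ fun j _ => hI i j]
    refine Finset.sum_congr rfl fun j _ => ?_
    rw [integral_const_mul, integral_integral_swap (hint i j),
      intervalIntegral.integral_of_le zero_le_one]
    congr 1
    refine integral_congr_ae (Eventually.of_forall fun s => ?_)
    simp only
    rw [integral_const_mul]

/-- The constant terms cancel, and each of the `d ^ 2` remainders is at most `|ξ| ^ 2` times a
Schwartz pairing of `μ - ν`, controlled by duality. The factor `‖ξ‖ ^ 4` is what later yields `t ^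
2`. -/
theorem exists_norm_charFun_sub_sq_le (d : ℕ) {R : ℝ} (hR : 0 ≤ R) :
    ∃ C : ℝ, 0 < C ∧ ∀ (μ ν : Measure (EuclideanSpace ℝ (Fin d))) [IsProbabilityMeasure μ]
      [IsProbabilityMeasure ν], (∀ᵐ x ∂μ, ‖x‖ ≤ R) → (∀ᵐ x ∂ν, ‖x‖ ≤ R) →
      ∫ x, x ∂μ = 0 → ∫ x, x ∂ν = 0 → ∀ ξ,
      ‖charFun μ ξ - charFun ν ξ‖ ^ 2
        ≤ C * ‖ξ‖ ^ 4 * (1 + ‖ξ‖ ^ 2) ^ (d + 1) * sobolevDist μ ν := by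
  choose g hg using fun i j : Fin d => exists_schwartz_eq_coord_mul_coord hR i j
  choose C hC0 hC using fun i j : Fin d => exists_norm_schwartz_pairing_sq_le (g i j)
  set C' := 1 + ∑ i, ∑ j, C i j with hC'
  have hsum : 0 ≤ ∑ i, ∑ j, C i j :=
    Finset.sum_nonneg fun i _ => Finset.sum_nonneg fun j _ => (hC0 i j).le
  have hCle : ∀ i j, C i j ≤ C' := by
    intro i j
    have h1 : C i j ≤ ∑ j, C i j :=
      Finset.single_le_sum (f := fun j => C i j) (fun j _ => (hC0 i j).le) (Finset.mem_univ j)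
    have h2 : ∑ j, C i j ≤ ∑ i, ∑ j, C i j :=
      Finset.single_le_sum (f := fun i => ∑ j, C i j)
        (fun i _ => Finset.sum_nonneg fun j _ => (hC0 i j).le) (Finset.mem_univ i)
    linarith
  refine ⟨((d : ℝ) ^ 2 + 1) ^ 2 * C', by positivity, fun μ ν _ _ hμ hν hmμ hmν ξ => ?_⟩
  obtain ⟨hiμ, hTμ⟩ := charFun_eq_taylor hg μ hμ hmμ ξ
  obtain ⟨hiν, hTν⟩ := charFun_eq_taylor hg ν hν hmν ξ
  have hN := sobolevDist_nonneg μ ν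
  set Q := C' * ((1 + ‖ξ‖ ^ 2) ^ (d + 1) * sobolevDist μ ν) with hQ
  have hQ0 : 0 ≤ Q := by positivity
  have hdiff : ∀ i j, ‖(∫ s in (0 : ℝ)..1, (1 - (s : ℂ))
        * ∫ x, g i j x * Complex.exp (inner ℝ x (s • ξ) * Complex.I) ∂μ)
      - ∫ s in (0 : ℝ)..1, (1 - (s : ℂ))
        * ∫ x, g i j x * Complex.exp (inner ℝ x (s • ξ) * Complex.I) ∂ν‖ ≤ √Q := by
    intro i j
    rw [← intervalIntegral.integral_sub (hiμ i j) (hiν i j)]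
    refine (intervalIntegral.norm_integral_le_of_norm_le_const (C := √Q) fun s hs => ?_).trans_eq
      (by simp)
    rw [Set.uIoc_of_le zero_le_one] at hs
    rw [← mul_sub, norm_mul]
    have h1 : ‖1 - (s : ℂ)‖ ≤ 1 := by
      rw [← Complex.ofReal_one, ← Complex.ofReal_sub, Complex.norm_real, Real.norm_eq_abs, abs_le]
      constructor <;> linarith [hs.1, hs.2]
    refine (mul_le_of_le_one_left (norm_nonneg _) h1).trans (Real.le_sqrt_of_sq_le ?_)
    refine (hC i j μ ν (s • ξ)).trans ?_
    rw [hQ, mul_assoc]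
    have h2 : ‖s • ξ‖ ≤ ‖ξ‖ := by
      rw [norm_smul, Real.norm_eq_abs, abs_of_pos hs.1]
      exact mul_le_of_le_one_left (norm_nonneg _) hs.2
    have h3 := hCle i j
    have h4 := (hC0 i j).le
    gcongr
  have hnorm : ‖charFun μ ξ - charFun ν ξ‖ ≤ (d : ℝ) ^ 2 * (‖ξ‖ ^ 2 * √Q) := by
    rw [hTμ, hTν, sub_sub_sub_cancel_left, ← Finset.sum_sub_distrib]
    have hterm : ∀ i j, ‖(ξ i : ℂ) * (ξ j : ℂ) * (∫ s in (0 : ℝ)..1, (1 - (s : ℂ))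
          * ∫ x, g i j x * Complex.exp (inner ℝ x (s • ξ) * Complex.I) ∂ν)
        - (ξ i : ℂ) * (ξ j : ℂ) * (∫ s in (0 : ℝ)..1, (1 - (s : ℂ))
          * ∫ x, g i j x * Complex.exp (inner ℝ x (s • ξ) * Complex.I) ∂μ)‖
        ≤ ‖ξ‖ ^ 2 * √Q := by
      intro i j
      rw [← mul_sub, norm_mul, norm_mul, Complex.norm_real, Complex.norm_real, sq, norm_sub_rev]
      have h1 := PiLp.norm_apply_le ξ i
      have h2 := PiLp.norm_apply_le ξ j
      have h3 := hdiff i j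
      gcongr
    refine (norm_sum_le _ _).trans ?_
    have h5 : ∀ i ∈ Finset.univ, ‖∑ j, (ξ i : ℂ) * (ξ j : ℂ) * (∫ s in (0 : ℝ)..1, (1 - (s : ℂ))
          * ∫ x, g i j x * Complex.exp (inner ℝ x (s • ξ) * Complex.I) ∂ν)
        - ∑ j, (ξ i : ℂ) * (ξ j : ℂ) * (∫ s in (0 : ℝ)..1, (1 - (s : ℂ))
          * ∫ x, g i j x * Complex.exp (inner ℝ x (s • ξ) * Complex.I) ∂μ)‖
        ≤ d * (‖ξ‖ ^ 2 * √Q) := by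
      intro i _
      rw [← Finset.sum_sub_distrib]
      refine (norm_sum_le_of_le _ fun j _ => hterm i j).trans_eq ?_
      simp
    refine (Finset.sum_le_sum h5).trans_eq ?_
    simp; ring
  calc ‖charFun μ ξ - charFun ν ξ‖ ^ 2 ≤ ((d : ℝ) ^ 2 * (‖ξ‖ ^ 2 * √Q)) ^ 2 := by gcongr
    _ = ((d : ℝ) ^ 2) ^ 2 * (‖ξ‖ ^ 4 * Q) := by
        rw [mul_pow, mul_pow, Real.sq_sqrt hQ0]; ring
    _ ≤ ((d : ℝ) ^ 2 + 1) ^ 2 * (‖ξ‖ ^ 4 * Q) := by gcongr; linarith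
    _ = _ := by rw [hQ]; ring

/-! ### Comparison of the attractive and repulsive forms. -/

/-- The energy of the difference of two measures for the mixture of Gaussian kernels which
represents `powerTerm c`. -/
noncomputable def mixtureDist {d : ℕ} (c : ℝ) (μ ν : Measure (EuclideanSpace ℝ (Fin d))) :
    ENNReal :=
  ∫⁻ t in Set.Ioi (0 : ℝ), ENNReal.ofReal (mixtureWeight c * t ^ (-c / 2 - 1) * gaussDist t μ ν)

theorem one_add_pow_le_exp (k : ℕ) {y : ℝ} (hy : 0 ≤ y) :
    (1 + y) ^ k ≤ 8 ^ k * k.factorial * Real.exp (1 / 8) * Real.exp (y / 8) := by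
  have h := Real.pow_div_factorial_le_exp ((1 + y) / 8) (by positivity) k
  rw [div_le_iff₀ (by positivity), div_pow, div_le_iff₀ (by positivity)] at h
  rw [mul_assoc _ (Real.exp _), ← Real.exp_add]
  calc (1 + y) ^ k ≤ _ := h
    _ = 8 ^ k * k.factorial * Real.exp ((1 + y) / 8) := by ring
    _ = _ := by congr 2; ring

section gaussDist

variable {d : ℕ}

/-- The Gaussian lives at `|ξ| ^ 2 ~ t`, so `‖ξ‖ ^ 4` counts as `t ^ 2`. Half of the exponent, `1 /
8` out of `1 / 4`, is spent on the polynomial in `y = |ξ| ^ 2 / t`. -/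
theorem fourierGaussian_mul_pow_le {t : ℝ} (ht : 0 < t) (ht1 : t ≤ 1)
    (ξ : EuclideanSpace ℝ (Fin d)) :
    fourierGaussian d t ξ * (‖ξ‖ ^ 4 * (1 + ‖ξ‖ ^ 2) ^ (d + 1))
      ≤ 8 ^ (d + 3) * (d + 3).factorial * Real.exp (1 / 8) * t ^ 2
        * ((4 * Real.pi * t) ^ (-(d : ℝ) / 2) * Real.exp (-(1 / (8 * t)) * ‖ξ‖ ^ 2)) := by
  set y := ‖ξ‖ ^ 2 / t with hy
  have hy0 : 0 ≤ y := by positivity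
  have hξ : ‖ξ‖ ^ 2 = t * y := by rw [hy]; field_simp
  have h1 : ‖ξ‖ ^ 4 * (1 + ‖ξ‖ ^ 2) ^ (d + 1) ≤ t ^ 2 * (1 + y) ^ (d + 3) := by
    have h2 : ‖ξ‖ ^ 4 = t ^ 2 * y ^ 2 := by
      rw [show ‖ξ‖ ^ 4 = (‖ξ‖ ^ 2) ^ 2 by ring, hξ]; ring
    rw [h2, hξ, show d + 3 = 2 + (d + 1) by ring, pow_add (1 + y) 2 (d + 1), mul_assoc]
    have h3 : t * y ≤ y := mul_le_of_le_one_left hy0 ht1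
    gcongr
    linarith
  have h4 := one_add_pow_le_exp (d + 3) hy0
  have he : Real.exp (-(1 / (4 * t)) * ‖ξ‖ ^ 2) * Real.exp (y / 8)
      = Real.exp (-(1 / (8 * t)) * ‖ξ‖ ^ 2) := by
    rw [← Real.exp_add, hξ]
    congr 1
    field_simp
    ring
  rw [← he, fourierGaussian]
  set A := (4 * Real.pi * t) ^ (-(d : ℝ) / 2) with hA
  have hA0 : 0 ≤ A := by positivity
  calc A * Real.exp (-(1 / (4 * t)) * ‖ξ‖ ^ 2) * (‖ξ‖ ^ 4 * (1 + ‖ξ‖ ^ 2) ^ (d + 1))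
      ≤ A * Real.exp (-(1 / (4 * t)) * ‖ξ‖ ^ 2) * (t ^ 2 * (8 ^ (d + 3) * (d + 3).factorial
        * Real.exp (1 / 8) * Real.exp (y / 8))) := by
        refine mul_le_mul_of_nonneg_left (h1.trans ?_) (by positivity)
        gcongr
    _ = _ := by ring

theorem exists_gaussDist_le_sq_mul_sobolevDist (d : ℕ) {R : ℝ} (hR : 0 ≤ R) :
    ∃ C : ℝ, 0 < C ∧ ∀ (μ ν : Measure (EuclideanSpace ℝ (Fin d))) [IsProbabilityMeasure μ]
      [IsProbabilityMeasure ν], (∀ᵐ x ∂μ, ‖x‖ ≤ R) → (∀ᵐ x ∂ν, ‖x‖ ≤ R) →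
      ∫ x, x ∂μ = 0 → ∫ x, x ∂ν = 0 → ∀ t, 0 < t → t ≤ 1 →
      gaussDist t μ ν ≤ C * t ^ 2 * sobolevDist μ ν := by
  obtain ⟨C, hC0, hC⟩ := exists_norm_charFun_sub_sq_le d hR
  set B : ℝ := 8 ^ (d + 3) * (d + 3).factorial * Real.exp (1 / 8) with hB
  refine ⟨C * B * 2 ^ ((d : ℝ) / 2), by positivity, fun μ ν _ _ hμ hν hmμ hmν t ht ht1 => ?_⟩
  have hN := sobolevDist_nonneg μ ν
  rw [gaussDist_eq_integral ht]
  have hint : Integrable fun ξ : EuclideanSpace ℝ (Fin d) => Real.exp (-(1 / (8 * t)) * ‖ξ‖ ^ 2) :=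
    integrable_exp_neg_mul_sq_norm (by positivity)
  calc ∫ ξ, fourierGaussian d t ξ * ‖charFun μ ξ - charFun ν ξ‖ ^ 2
      ≤ ∫ ξ : EuclideanSpace ℝ (Fin d), C * sobolevDist μ ν * (B * t ^ 2)
        * (4 * Real.pi * t) ^ (-(d : ℝ) / 2) * Real.exp (-(1 / (8 * t)) * ‖ξ‖ ^ 2) := by
        refine integral_mono (integrable_mul_bounded (integrable_fourierGaussian ht)
          (measurable_norm_charFun_sub_sq μ ν) (norm_charFun_sub_sq_le μ ν))
          (hint.const_mul _) fun ξ => ?_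
        have h1 := fourierGaussian_mul_pow_le ht ht1 ξ
        rw [← hB] at h1
        calc fourierGaussian d t ξ * ‖charFun μ ξ - charFun ν ξ‖ ^ 2
            ≤ fourierGaussian d t ξ
              * (C * ‖ξ‖ ^ 4 * (1 + ‖ξ‖ ^ 2) ^ (d + 1) * sobolevDist μ ν) :=
              mul_le_mul_of_nonneg_left (hC μ ν hμ hν hmμ hmν ξ) (fourierGaussian_nonneg ht ξ)
          _ = C * sobolevDist μ ν
              * (fourierGaussian d t ξ * (‖ξ‖ ^ 4 * (1 + ‖ξ‖ ^ 2) ^ (d + 1))) := by ring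
          _ ≤ C * sobolevDist μ ν * _ := mul_le_mul_of_nonneg_left h1 (by positivity)
          _ = _ := by ring
    _ = _ := by
        rw [integral_const_mul, GaussianFourier.integral_rexp_neg_mul_sq_norm (by positivity)]
        have h2 : Real.pi / (1 / (8 * t)) = 2 * (4 * Real.pi * t) := by field_simp; ring
        have h3 : (4 * Real.pi * t) ^ (-(d : ℝ) / 2) * (4 * Real.pi * t) ^ ((d : ℝ) / 2) = 1 := by
          rw [← Real.rpow_add (by positivity), neg_div, neg_add_cancel, Real.rpow_zero]
        rw [h2, finrank_euclideanSpace, Fintype.card_fin,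
          Real.mul_rpow (x := 2) (y := 4 * Real.pi * t) (by norm_num) (by positivity)]
        linear_combination (C * sobolevDist μ ν * (B * t ^ 2) * 2 ^ ((d : ℝ) / 2)) * h3

/-- Only the window `s < t ≤ 2 s` with `s = 1 + |ξ| ^ 2` is kept. There the exponential is at least
`exp (-1 / 4)`, and the rest contributes about `s ^ (-(b + d) / 2)`, which beats `s ^ (-(d + 1))`.
-/
theorem mul_inv_pow_le_lintegral_fourierGaussian {b : ℝ} (hbd : -(d : ℝ) < b) (hb2 : b < 2) :
    ∃ c : ℝ, 0 < c ∧ ∀ ξ : EuclideanSpace ℝ (Fin d),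
      ENNReal.ofReal (c * ((1 + ‖ξ‖ ^ 2) ^ (d + 1))⁻¹)
        ≤ ∫⁻ t in Set.Ioi (1 : ℝ), ENNReal.ofReal (t ^ (-b / 2 - 1) * fourierGaussian d t ξ) := by
  set e : ℝ := -(b + d) / 2 - 1 with he
  set c : ℝ := (4 * Real.pi) ^ (-(d : ℝ) / 2) * 2 ^ e * Real.exp (-(1 / 4)) with hc
  refine ⟨c, by positivity, fun ξ => ?_⟩
  set s := 1 + ‖ξ‖ ^ 2 with hs
  have hs1 : 1 ≤ s := by rw [hs]; linarith [sq_nonneg ‖ξ‖]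
  have hs0 : 0 < s := by linarith
  have hd0 : (0 : ℝ) ≤ d := d.cast_nonneg
  calc ENNReal.ofReal (c * (s ^ (d + 1))⁻¹)
      ≤ ENNReal.ofReal (c * s ^ e * s) := by
        refine ENNReal.ofReal_le_ofReal ?_
        rw [mul_assoc c, ← Real.rpow_add_one hs0.ne', ← Real.rpow_natCast, ← Real.rpow_neg hs0.le]
        refine mul_le_mul_of_nonneg_left ?_ (by positivity)
        refine Real.rpow_le_rpow_of_exponent_le hs1 ?_
        rw [he]; push_cast; linarith
    _ = ∫⁻ t in Set.Ioc s (2 * s), ENNReal.ofReal (c * s ^ e) := by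
        rw [setLIntegral_const, Real.volume_Ioc, ← ENNReal.ofReal_mul (by positivity)]
        congr 1; ring
    _ ≤ ∫⁻ t in Set.Ioc s (2 * s), ENNReal.ofReal (t ^ (-b / 2 - 1) * fourierGaussian d t ξ) := by
        refine setLIntegral_mono' measurableSet_Ioc fun t ht => ENNReal.ofReal_le_ofReal ?_
        have ht0 : 0 < t := hs0.trans ht.1
        have h1 : t ^ (-b / 2 - 1) * fourierGaussian d t ξ
            = (4 * Real.pi) ^ (-(d : ℝ) / 2) * t ^ e * Real.exp (-(1 / (4 * t)) * ‖ξ‖ ^ 2) := by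
          rw [fourierGaussian, Real.mul_rpow (by positivity) ht0.le, he,
            show -(b + d) / 2 - 1 = (-b / 2 - 1) + -(d : ℝ) / 2 by ring, Real.rpow_add ht0]
          ring
        have h2 : 2 ^ e * s ^ e ≤ t ^ e := by
          rw [← Real.mul_rpow (by norm_num) hs0.le]
          exact Real.rpow_le_rpow_of_nonpos ht0 ht.2 (by rw [he]; linarith)
        have h3 : Real.exp (-(1 / 4)) ≤ Real.exp (-(1 / (4 * t)) * ‖ξ‖ ^ 2) := by
          refine Real.exp_le_exp.2 ?_
          have h4 : ‖ξ‖ ^ 2 ≤ t := by linarith [ht.1]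
          rw [neg_mul, neg_le_neg_iff, div_mul_eq_mul_div, one_mul,
            div_le_div_iff₀ (by positivity) (by norm_num)]
          linarith
        rw [h1, hc]
        calc (4 * Real.pi) ^ (-(d : ℝ) / 2) * 2 ^ e * Real.exp (-(1 / 4)) * s ^ e
            = (4 * Real.pi) ^ (-(d : ℝ) / 2) * (2 ^ e * s ^ e) * Real.exp (-(1 / 4)) := by ring
          _ ≤ _ := by gcongr
    _ ≤ _ := lintegral_mono_set fun t ht => hs1.trans_lt ht.1

theorem exists_sobolevDist_le_lintegral_gaussDist {b : ℝ} (hbd : -(d : ℝ) < b) (hb2 : b < 2) :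
    ∃ C : ℝ, 0 < C ∧ ∀ (μ ν : Measure (EuclideanSpace ℝ (Fin d))) [IsProbabilityMeasure μ]
      [IsProbabilityMeasure ν], ENNReal.ofReal (sobolevDist μ ν) ≤ ENNReal.ofReal C
        * ∫⁻ t in Set.Ioi (1 : ℝ), ENNReal.ofReal (t ^ (-b / 2 - 1) * gaussDist t μ ν) := by
  obtain ⟨c, hc0, hc⟩ := mul_inv_pow_le_lintegral_fourierGaussian hbd hb2
  refine ⟨c⁻¹, by positivity, fun μ ν _ _ => ?_⟩
  have hmeas := measurable_norm_charFun_sub_sq μ ν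
  have hJ : ∫⁻ t in Set.Ioi (1 : ℝ), ENNReal.ofReal (t ^ (-b / 2 - 1) * gaussDist t μ ν)
      = ∫⁻ ξ, ∫⁻ t in Set.Ioi (1 : ℝ), ENNReal.ofReal (t ^ (-b / 2 - 1) * fourierGaussian d t ξ)
        * ENNReal.ofReal (‖charFun μ ξ - charFun ν ξ‖ ^ 2) := by
    rw [← lintegral_lintegral_swap]
    · refine setLIntegral_congr_fun measurableSet_Ioi fun t ht => ?_
      have ht0 : (0 : ℝ) < t := zero_lt_one.trans ht
      rw [gaussDist_eq_integral ht0, ← integral_const_mul, ofReal_integral_eq_lintegral_ofReal]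
      · refine lintegral_congr fun ξ => ?_
        rw [← mul_assoc, ENNReal.ofReal_mul]
        have := fourierGaussian_nonneg ht0 ξ
        positivity
      · exact (integrable_mul_bounded (integrable_fourierGaussian ht0) hmeas
          (norm_charFun_sub_sq_le μ ν)).const_mul _
      · refine Eventually.of_forall fun ξ => ?_
        have := fourierGaussian_nonneg ht0 ξ
        simp only [Pi.zero_apply]
        positivity
    · have h1 : Measurable fun p : ℝ × EuclideanSpace ℝ (Fin d) =>
          ENNReal.ofReal (p.1 ^ (-b / 2 - 1) * fourierGaussian d p.1 p.2) := by
        unfold fourierGaussian; fun_prop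
      exact (h1.mul (hmeas.comp measurable_snd).ennreal_ofReal).aemeasurable
  rw [hJ, sobolevDist, ofReal_integral_eq_lintegral_ofReal (integrable_sobolevDist μ ν)
    (Eventually.of_forall fun η => by simp only [Pi.zero_apply]; positivity),
    ← lintegral_const_mul' _ _ ENNReal.ofReal_ne_top]
  refine lintegral_mono fun ξ => ?_
  rw [lintegral_mul_const' _ _ ENNReal.ofReal_ne_top, ENNReal.ofReal_mul (by positivity),
    ← mul_assoc]
  refine mul_le_mul_left ?_ _
  calc ENNReal.ofReal ((1 + ‖ξ‖ ^ 2) ^ (d + 1))⁻¹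
      = ENNReal.ofReal c⁻¹ * ENNReal.ofReal (c * ((1 + ‖ξ‖ ^ 2) ^ (d + 1))⁻¹) := by
        rw [← ENNReal.ofReal_mul (by positivity), inv_mul_cancel_left₀ hc0.ne']
    _ ≤ _ := by gcongr; exact hc ξ

theorem mixtureWeight_mul_lintegral_le_mixtureDist {b : ℝ} (hb2 : b < 2)
    (μ ν : Measure (EuclideanSpace ℝ (Fin d))) :
    ENNReal.ofReal (mixtureWeight b)
      * ∫⁻ t in Set.Ioi (1 : ℝ), ENNReal.ofReal (t ^ (-b / 2 - 1) * gaussDist t μ ν)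
      ≤ mixtureDist b μ ν := by
  rw [← lintegral_const_mul' _ _ ENNReal.ofReal_ne_top, mixtureDist]
  refine le_trans (le_of_eq ?_) (lintegral_mono_set (Set.Ioi_subset_Ioi zero_le_one))
  refine lintegral_congr fun t => ?_
  rw [← ENNReal.ofReal_mul (mixtureWeight_pos hb2).le, mul_assoc]

/-- The split at `t = 1` bounds both halves by the part `t > 1` of the `b`-mixture. Only
`mixtureWeight a` depends on `a`. -/
theorem exists_mixtureDist_le {b : ℝ} (hbd : -(d : ℝ) < b) (hb2 : b < 2) {R : ℝ} (hR : 0 ≤ R) :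
    ∃ C : ℝ, 0 < C ∧ ∀ (μ ν : Measure (EuclideanSpace ℝ (Fin d))) [IsProbabilityMeasure μ]
      [IsProbabilityMeasure ν], (∀ᵐ x ∂μ, ‖x‖ ≤ R) → (∀ᵐ x ∂ν, ‖x‖ ≤ R) →
      ∫ x, x ∂μ = 0 → ∫ x, x ∂ν = 0 → ∀ a, b < a → a < 2 →
      mixtureDist a μ ν ≤ ENNReal.ofReal (mixtureWeight a * C) * mixtureDist b μ ν := by
  obtain ⟨C₁, hC₁, h₁⟩ := exists_gaussDist_le_sq_mul_sobolevDist d hR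
  obtain ⟨C₂, hC₂, h₂⟩ := exists_sobolevDist_le_lintegral_gaussDist hbd hb2
  have hκb := mixtureWeight_pos hb2
  refine ⟨(C₁ * C₂ + 1) * (mixtureWeight b)⁻¹, by positivity,
    fun μ ν _ _ hμ hν hmμ hmν a hba ha2 => ?_⟩
  have hκa := mixtureWeight_pos ha2
  have hN := sobolevDist_nonneg μ ν
  set J := ∫⁻ t in Set.Ioi (1 : ℝ), ENNReal.ofReal (t ^ (-b / 2 - 1) * gaussDist t μ ν) with hJ
  have hsmall : ∫⁻ t in Set.Ioc (0 : ℝ) 1, ENNReal.ofReal (t ^ (-a / 2 - 1) * gaussDist t μ ν)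
      ≤ ENNReal.ofReal (C₁ * sobolevDist μ ν) := by
    calc _ ≤ ∫⁻ _ in Set.Ioc (0 : ℝ) 1, ENNReal.ofReal (C₁ * sobolevDist μ ν) := by
          refine setLIntegral_mono' measurableSet_Ioc fun t ht => ENNReal.ofReal_le_ofReal ?_
          have h3 := h₁ μ ν hμ hν hmμ hmν t ht.1 ht.2
          -- The total exponent `1 - a / 2` is positive, so the bound is uniform as `a → 2`.
          have h4 : t ^ (-a / 2 - 1) * t ^ 2 ≤ 1 := by
            rw [← Real.rpow_natCast, ← Real.rpow_add ht.1]
            refine Real.rpow_le_one ht.1.le ht.2 ?_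
            push_cast; linarith
          calc t ^ (-a / 2 - 1) * gaussDist t μ ν
              ≤ t ^ (-a / 2 - 1) * (C₁ * t ^ 2 * sobolevDist μ ν) :=
                mul_le_mul_of_nonneg_left h3 (Real.rpow_nonneg ht.1.le _)
            _ = (t ^ (-a / 2 - 1) * t ^ 2) * (C₁ * sobolevDist μ ν) := by ring
            _ ≤ C₁ * sobolevDist μ ν := mul_le_of_le_one_left (by positivity) h4
      _ = _ := by simp
  have hlarge : ∫⁻ t in Set.Ioi (1 : ℝ), ENNReal.ofReal (t ^ (-a / 2 - 1) * gaussDist t μ ν)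
      ≤ J := by
    refine setLIntegral_mono' measurableSet_Ioi fun t ht => ENNReal.ofReal_le_ofReal ?_
    have ht1 : (1 : ℝ) < t := ht
    refine mul_le_mul_of_nonneg_right ?_ (gaussDist_nonneg (by linarith) μ ν)
    exact Real.rpow_le_rpow_of_exponent_le ht1.le (by linarith)
  have hsplit : mixtureDist a μ ν = ENNReal.ofReal (mixtureWeight a)
      * ((∫⁻ t in Set.Ioc (0 : ℝ) 1, ENNReal.ofReal (t ^ (-a / 2 - 1) * gaussDist t μ ν))
        + ∫⁻ t in Set.Ioi (1 : ℝ), ENNReal.ofReal (t ^ (-a / 2 - 1) * gaussDist t μ ν)) := by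
    rw [← lintegral_union measurableSet_Ioi (Set.Ioc_disjoint_Ioi le_rfl),
      Set.Ioc_union_Ioi_eq_Ioi zero_le_one, ← lintegral_const_mul' _ _ ENNReal.ofReal_ne_top,
      mixtureDist]
    refine lintegral_congr fun t => ?_
    rw [← ENNReal.ofReal_mul hκa.le, mul_assoc]
  have hN' : ENNReal.ofReal (C₁ * sobolevDist μ ν) ≤ ENNReal.ofReal (C₁ * C₂) * J := by
    rw [ENNReal.ofReal_mul hC₁.le, ENNReal.ofReal_mul hC₁.le, mul_assoc]
    gcongr
    exact h₂ μ ν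
  have hb := mixtureWeight_mul_lintegral_le_mixtureDist hb2 μ ν
  calc mixtureDist a μ ν ≤ ENNReal.ofReal (mixtureWeight a)
        * (ENNReal.ofReal (C₁ * C₂) * J + J) := by
        rw [hsplit]
        gcongr
        exact hsmall.trans hN'
    _ = ENNReal.ofReal (mixtureWeight a * ((C₁ * C₂ + 1) * (mixtureWeight b)⁻¹))
        * (ENNReal.ofReal (mixtureWeight b) * J) := by
        rw [← mul_assoc (ENNReal.ofReal _) (ENNReal.ofReal (mixtureWeight b)),
          ← ENNReal.ofReal_mul (by positivity)]
        have h5 : mixtureWeight a * ((C₁ * C₂ + 1) * (mixtureWeight b)⁻¹) * mixtureWeight b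
            = mixtureWeight a * (C₁ * C₂ + 1) := by field_simp
        rw [h5, ENNReal.ofReal_mul hκa.le, ENNReal.ofReal_add (by positivity) zero_le_one,
          ENNReal.ofReal_one]
        ring
    _ ≤ _ := by gcongr

/-- The Sobolev norm of the difference vanishes, and it controls the characteristic functions at
every frequency, not just almost everywhere. -/
theorem eq_of_mixtureDist_eq_zero {b : ℝ} (hbd : -(d : ℝ) < b) (hb2 : b < 2) {R : ℝ} (hR : 0 ≤ R)
    {μ ν : Measure (EuclideanSpace ℝ (Fin d))} [IsProbabilityMeasure μ] [IsProbabilityMeasure ν]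
    (hμ : ∀ᵐ x ∂μ, ‖x‖ ≤ R) (hν : ∀ᵐ x ∂ν, ‖x‖ ≤ R) (hmμ : ∫ x, x ∂μ = 0) (hmν : ∫ x, x ∂ν = 0)
    (h : mixtureDist b μ ν = 0) : μ = ν := by
  obtain ⟨C₁, -, h₁⟩ := exists_norm_charFun_sub_sq_le d hR
  obtain ⟨C₂, -, h₂⟩ := exists_sobolevDist_le_lintegral_gaussDist hbd hb2
  have hJ := mixtureWeight_mul_lintegral_le_mixtureDist hb2 μ ν
  rw [h, nonpos_iff_eq_zero, mul_eq_zero] at hJ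
  have hJ0 := hJ.resolve_left (by simpa using mixtureWeight_pos hb2)
  have hN := h₂ μ ν
  rw [hJ0, mul_zero, nonpos_iff_eq_zero, ENNReal.ofReal_eq_zero] at hN
  have hN0 := le_antisymm hN (sobolevDist_nonneg μ ν)
  refine Measure.ext_of_charFun (funext fun ξ => ?_)
  have h3 := h₁ μ ν hμ hν hmμ hmν ξ
  rw [hN0, mul_zero] at h3
  rw [← sub_eq_zero, ← norm_eq_zero]
  exact pow_eq_zero_iff (two_ne_zero) |>.1 (le_antisymm h3 (by positivity))

end gaussDist

/-! ### The energy as a difference of two Gaussian mixtures. -/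

section mixture

variable {d : ℕ}

theorem measurable_gaussPair (μ ν : Measure (EuclideanSpace ℝ (Fin d))) [SFinite μ] [SFinite ν] :
    Measurable fun t => gaussPair t μ ν := by
  have h : StronglyMeasurable (Function.uncurry fun (t : ℝ)
      (z : EuclideanSpace ℝ (Fin d) × EuclideanSpace ℝ (Fin d)) =>
      Real.exp (-t * ‖z.1 - z.2‖ ^ 2)) :=
    Continuous.stronglyMeasurable (by fun_prop)
  exact h.integral_prod_right.measurable

theorem integrable_gaussKernel {t : ℝ} (ht : 0 < t) (μ ν : Measure (EuclideanSpace ℝ (Fin d)))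
    [IsProbabilityMeasure μ] [IsProbabilityMeasure ν] :
    Integrable (fun z => Real.exp (-t * ‖z.1 - z.2‖ ^ 2)) (μ.prod ν) := by
  refine Integrable.mono' (integrable_const 1) (Continuous.aestronglyMeasurable (by fun_prop))
    (Eventually.of_forall fun z => ?_)
  rw [Real.norm_eq_abs, abs_of_pos (Real.exp_pos _), Real.exp_le_one_iff]
  nlinarith [sq_nonneg ‖z.1 - z.2‖]

theorem ae_norm_sub_le {R : ℝ} {μ ν : Measure (EuclideanSpace ℝ (Fin d))}
    [IsProbabilityMeasure μ] [IsProbabilityMeasure ν]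
    (hμ : ∀ᵐ x ∂μ, ‖x‖ ≤ R) (hν : ∀ᵐ x ∂ν, ‖x‖ ≤ R) :
    ∀ᵐ z ∂(μ.prod ν), ‖z.1 - z.2‖ ≤ 2 * R := by
  filter_upwards [Measure.quasiMeasurePreserving_fst.ae hμ,
    Measure.quasiMeasurePreserving_snd.ae hν] with z h1 h2
  linarith [norm_sub_le z.1 z.2]

theorem exp_le_gaussPair {t D : ℝ} (ht : 0 < t) {μ ν : Measure (EuclideanSpace ℝ (Fin d))}
    [IsProbabilityMeasure μ] [IsProbabilityMeasure ν]
    (h : ∀ᵐ z ∂(μ.prod ν), ‖z.1 - z.2‖ ≤ D) : Real.exp (-t * D ^ 2) ≤ gaussPair t μ ν := by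
  have h1 : ∫ _, Real.exp (-t * D ^ 2) ∂(μ.prod ν) ≤ gaussPair t μ ν := by
    refine integral_mono_ae (integrable_const _) (integrable_gaussKernel ht μ ν) ?_
    filter_upwards [h] with z hz
    refine Real.exp_le_exp.2 ?_
    have : ‖z.1 - z.2‖ ^ 2 ≤ D ^ 2 := by gcongr
    nlinarith
  simpa using h1

theorem pairEnergy_radialGap_eq {c D : ℝ} (hc : c < 2)
    {μ ν : Measure (EuclideanSpace ℝ (Fin d))} [IsProbabilityMeasure μ] [IsProbabilityMeasure ν]
    (h : ∀ᵐ z ∂(μ.prod ν), ‖z.1 - z.2‖ ≤ D) :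
    pairEnergy (fun x => radialGap c D ‖x‖) μ ν = ∫⁻ t in Set.Ioi (0 : ℝ),
      ENNReal.ofReal (mixtureWeight c * t ^ (-c / 2 - 1)
        * (gaussPair t μ ν - Real.exp (-t * D ^ 2))) := by
  have hκ := mixtureWeight_pos hc
  rw [pairEnergy_eq_lintegral_prod (V := fun x => radialGap c D ‖x‖)
    ((measurable_radialGap c D).comp measurable_norm)]
  unfold radialGap
  rw [lintegral_lintegral_swap (Measurable.aemeasurable (by fun_prop))]
  refine setLIntegral_congr_fun measurableSet_Ioi fun t ht => ?_
  have ht0 : (0 : ℝ) < t := ht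
  rw [← ofReal_integral_eq_lintegral_ofReal]
  · rw [integral_const_mul, integral_sub (integrable_gaussKernel ht0 μ ν) (integrable_const _)]
    simp [gaussPair]
  · exact ((integrable_gaussKernel ht0 μ ν).sub (integrable_const _)).const_mul _
  · filter_upwards [h] with z hz
    have h1 : Real.exp (-t * D ^ 2) ≤ Real.exp (-t * ‖z.1 - z.2‖ ^ 2) := by
      refine Real.exp_le_exp.2 ?_
      have : ‖z.1 - z.2‖ ^ 2 ≤ D ^ 2 := by gcongr
      nlinarith
    simp only [Pi.zero_apply]
    have := sub_nonneg.2 h1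
    positivity

/-- Under the `t`-integral the subtracted constants `exp (-t D ^ 2)` cancel because all masses are
`1`, and `gaussDist` remains. -/
theorem pairEnergy_radialGap_add {c R : ℝ} (hc : c < 2)
    {μ ν : Measure (EuclideanSpace ℝ (Fin d))} [IsProbabilityMeasure μ] [IsProbabilityMeasure ν]
    (hμ : ∀ᵐ x ∂μ, ‖x‖ ≤ R) (hν : ∀ᵐ x ∂ν, ‖x‖ ≤ R) :
    pairEnergy (fun x => radialGap c (2 * R) ‖x‖) μ μ
        + pairEnergy (fun x => radialGap c (2 * R) ‖x‖) ν ν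
      = 2 * pairEnergy (fun x => radialGap c (2 * R) ‖x‖) μ ν + mixtureDist c μ ν := by
  have hκ := mixtureWeight_pos hc
  have h00 := ae_norm_sub_le hμ hμ
  have h11 := ae_norm_sub_le hν hν
  have h01 := ae_norm_sub_le hμ hν
  have hm : ∀ (μ ν : Measure (EuclideanSpace ℝ (Fin d))) [IsProbabilityMeasure μ]
      [IsProbabilityMeasure ν], Measurable fun t : ℝ =>
      ENNReal.ofReal (mixtureWeight c * t ^ (-c / 2 - 1)
        * (gaussPair t μ ν - Real.exp (-t * (2 * R) ^ 2))) := by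
    intro μ ν _ _
    have := measurable_gaussPair μ ν
    fun_prop
  rw [pairEnergy_radialGap_eq hc h00, pairEnergy_radialGap_eq hc h11,
    pairEnergy_radialGap_eq hc h01, mixtureDist, ← lintegral_add_left (hm μ μ),
    ← lintegral_const_mul _ (hm μ ν), ← lintegral_add_left ((hm μ ν).const_mul 2)]
  refine setLIntegral_congr_fun measurableSet_Ioi fun t ht => ?_
  have ht0 : (0 : ℝ) < t := ht
  have e00 := sub_nonneg.2 (exp_le_gaussPair ht0 h00)
  have e11 := sub_nonneg.2 (exp_le_gaussPair ht0 h11)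
  have e01 := sub_nonneg.2 (exp_le_gaussPair ht0 h01)
  have eD := gaussDist_nonneg ht0 μ ν
  have h2 : (2 : ENNReal) = ENNReal.ofReal 2 := by simp
  rw [h2, ← ENNReal.ofReal_mul (by norm_num), ← ENNReal.ofReal_add (by positivity) (by positivity),
    ← ENNReal.ofReal_add (by positivity) (by positivity), gaussDist]
  congr 1; ring

theorem pairEnergy_shiftedKernel_add {a b R : ℝ} (ha : 0 < a) (ha2 : a < 2) (hab : b < a)
    (hR : 0 < R) {μ ν : Measure (EuclideanSpace ℝ (Fin d))} [IsProbabilityMeasure μ]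
    [IsProbabilityMeasure ν] (hμ : ∀ᵐ x ∂μ, ‖x‖ ≤ R) (hν : ∀ᵐ x ∂ν, ‖x‖ ≤ R) :
    pairEnergy (shiftedKernel d a b) μ ν + pairEnergy (fun x => radialGap a (2 * R) ‖x‖) μ ν
      = pairEnergy (fun x => radialGap b (2 * R) ‖x‖) μ ν
        + ENNReal.ofReal (powerTerm a (2 * R) - powerTerm b (2 * R) + |powerTerm b 1|) := by
  have hV := (continuous_shiftedKernel (d := d) (b := b) ha).measurable
  have hg : ∀ c, Measurable fun x : EuclideanSpace ℝ (Fin d) => radialGap c (2 * R) ‖x‖ :=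
    fun c => (measurable_radialGap c _).comp measurable_norm
  rw [pairEnergy_eq_lintegral_prod hV, pairEnergy_eq_lintegral_prod (hg a),
    pairEnergy_eq_lintegral_prod (hg b), ← lintegral_add_left (measurable_pairKernel hV)]
  have h1 : ∀ᵐ z ∂(μ.prod ν), shiftedKernel d a b (z.1 - z.2) + radialGap a (2 * R) ‖z.1 - z.2‖
      = radialGap b (2 * R) ‖z.1 - z.2‖
        + ENNReal.ofReal (powerTerm a (2 * R) - powerTerm b (2 * R) + |powerTerm b 1|) := by
    filter_upwards [ae_norm_sub_le hμ hν] with z hz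
    exact shiftedKernel_add_radialGap ha ha2 hab (by linarith) hz
  rw [lintegral_congr_ae h1, lintegral_add_right _ measurable_const]
  simp

/-- For a positive exponent the gap is bounded, so the attractive part can be subtracted in real
arithmetic. -/
theorem pairEnergy_radialGap_ne_top {a R : ℝ} (ha : 0 < a) (ha2 : a < 2)
    {μ ν : Measure (EuclideanSpace ℝ (Fin d))} [IsProbabilityMeasure μ]
    [IsProbabilityMeasure ν] (hμ : ∀ᵐ x ∂μ, ‖x‖ ≤ R) (hν : ∀ᵐ x ∂ν, ‖x‖ ≤ R) :
    pairEnergy (fun x => radialGap a (2 * R) ‖x‖) μ ν ≠ ⊤ := by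
  rw [pairEnergy_eq_lintegral_prod (V := fun x => radialGap a (2 * R) ‖x‖)
    ((measurable_radialGap a _).comp measurable_norm)]
  have h : ∀ᵐ z ∂(μ.prod ν), radialGap a (2 * R) ‖z.1 - z.2‖
      ≤ ENNReal.ofReal (powerTerm a (2 * R)) := by
    filter_upwards [ae_norm_sub_le hμ hν] with z hz
    rw [radialGap_eq ha2 (norm_nonneg _) hz (Or.inr ha)]
    exact ENNReal.ofReal_le_ofReal (by linarith [powerTerm_nonneg ha (norm_nonneg (z.1 - z.2))])
  refine ((lintegral_mono_ae h).trans_lt ?_).ne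
  simp

/-- The energy of `μ - ν` equals `Q_b - Q_a`. Since `hle` makes it nonpositive, `Q_b ≤ Q_a ≤ q Q_b`,
hence `Q_b = 0`. Most of the work is to check that every term is finite. -/
theorem eq_of_pairEnergy_add_le {a b R q : ℝ} (hbd : -(d : ℝ) < b) (ha : 0 < a) (ha2 : a < 2)
    (hab : b < a) (hR : 0 < R) {μ ν : Measure (EuclideanSpace ℝ (Fin d))}
    [IsProbabilityMeasure μ] [IsProbabilityMeasure ν] (hμ : ∀ᵐ x ∂μ, ‖x‖ ≤ R)
    (hν : ∀ᵐ x ∂ν, ‖x‖ ≤ R) (hmμ : ∫ x, x ∂μ = 0) (hmν : ∫ x, x ∂ν = 0) (hq : q < 1)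
    (hdist : mixtureDist a μ ν ≤ ENNReal.ofReal q * mixtureDist b μ ν)
    (hfin₀ : pairEnergy (shiftedKernel d a b) μ μ ≠ ⊤)
    (hfin₁ : pairEnergy (shiftedKernel d a b) ν ν ≠ ⊤)
    (hle : pairEnergy (shiftedKernel d a b) μ μ + pairEnergy (shiftedKernel d a b) ν ν
      ≤ 2 * pairEnergy (shiftedKernel d a b) μ ν) : μ = ν := by
  have e00 := pairEnergy_shiftedKernel_add (b := b) ha ha2 hab hR hμ hμ
  have e11 := pairEnergy_shiftedKernel_add (b := b) ha ha2 hab hR hν hν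
  have e01 := pairEnergy_shiftedKernel_add (b := b) ha ha2 hab hR hμ hν
  have fa := pairEnergy_radialGap_add ha2 hμ hν
  have fb := pairEnergy_radialGap_add (hab.trans ha2) hμ hν
  have t00 := pairEnergy_radialGap_ne_top ha ha2 hμ hμ
  have t11 := pairEnergy_radialGap_ne_top ha ha2 hν hν
  have t01 := pairEnergy_radialGap_ne_top ha ha2 hμ hν
  have hk : ENNReal.ofReal (powerTerm a (2 * R) - powerTerm b (2 * R) + |powerTerm b 1|) ≠ ⊤ :=
    ENNReal.ofReal_ne_top
  have hzero := eq_of_mixtureDist_eq_zero hbd (hab.trans ha2) hR.le hμ hν hmμ hmν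
  generalize ENNReal.ofReal (powerTerm a (2 * R) - powerTerm b (2 * R) + |powerTerm b 1|) = k at *
  generalize pairEnergy (shiftedKernel d a b) μ μ = I00 at *
  generalize pairEnergy (shiftedKernel d a b) ν ν = I11 at *
  generalize pairEnergy (shiftedKernel d a b) μ ν = I01 at *
  generalize pairEnergy (fun x => radialGap a (2 * R) ‖x‖) μ μ = A00 at *
  generalize pairEnergy (fun x => radialGap a (2 * R) ‖x‖) ν ν = A11 at *
  generalize pairEnergy (fun x => radialGap a (2 * R) ‖x‖) μ ν = A01 at *
  generalize pairEnergy (fun x => radialGap b (2 * R) ‖x‖) μ μ = B00 at *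
  generalize pairEnergy (fun x => radialGap b (2 * R) ‖x‖) ν ν = B11 at *
  generalize pairEnergy (fun x => radialGap b (2 * R) ‖x‖) μ ν = B01 at *
  generalize mixtureDist a μ ν = QA at *
  generalize mixtureDist b μ ν = QB at *
  have b00 : B00 ≠ ⊤ := fun h => by
    rw [h, top_add] at e00
    exact ENNReal.add_ne_top.2 ⟨hfin₀, t00⟩ e00
  have b11 : B11 ≠ ⊤ := fun h => by
    rw [h, top_add] at e11
    exact ENNReal.add_ne_top.2 ⟨hfin₁, t11⟩ e11
  -- Finiteness of the cross energy and of `Q_b` follows from that of the self-energies, by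
  -- positivity of the form.
  have hs : 2 * B01 + QB ≠ ⊤ := fb ▸ ENNReal.add_ne_top.2 ⟨b00, b11⟩
  have hQB : QB ≠ ⊤ := (ENNReal.add_ne_top.1 hs).2
  have b01 : B01 ≠ ⊤ := fun h => by simp [h] at hs
  have hi01 : I01 ≠ ⊤ := fun h => by
    rw [h, top_add] at e01
    exact ENNReal.add_ne_top.2 ⟨b01, hk⟩ e01.symm
  have hQA : QA ≠ ⊤ := ne_top_of_le_ne_top (ENNReal.mul_ne_top ENNReal.ofReal_ne_top hQB) hdist
  lift k to NNReal using hk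
  lift I00 to NNReal using hfin₀
  lift I11 to NNReal using hfin₁
  lift I01 to NNReal using hi01
  lift A00 to NNReal using t00
  lift A11 to NNReal using t11
  lift A01 to NNReal using t01
  lift B00 to NNReal using b00
  lift B11 to NNReal using b11
  lift B01 to NNReal using b01
  lift QA to NNReal using hQA
  lift QB to NNReal using hQB
  have e00' : (I00 : ℝ) + A00 = B00 + k := by exact_mod_cast e00
  have e11' : (I11 : ℝ) + A11 = B11 + k := by exact_mod_cast e11
  have e01' : (I01 : ℝ) + A01 = B01 + k := by exact_mod_cast e01
  have fa' : (A00 : ℝ) + A11 = 2 * A01 + QA := by exact_mod_cast fa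
  have fb' : (B00 : ℝ) + B11 = 2 * B01 + QB := by exact_mod_cast fb
  have hle' : (I00 : ℝ) + I11 ≤ 2 * I01 := by exact_mod_cast hle
  have hQ : (QB : ℝ) ≤ QA := by linarith
  refine hzero ?_
  by_contra hne
  have hpos : (0 : ℝ) < QB := by
    have : QB ≠ 0 := fun h => hne (by rw [h]; simp)
    exact_mod_cast pos_iff_ne_zero.2 this
  have hlt : ENNReal.ofReal q * (QB : ENNReal) < 1 * (QB : ENNReal) := by
    rw [ENNReal.mul_lt_mul_iff_left hne ENNReal.coe_ne_top]
    rwa [← ENNReal.ofReal_one, ENNReal.ofReal_lt_ofReal_iff one_pos]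
  rw [one_mul] at hlt
  have h3 : (QA : ℝ) < QB := by exact_mod_cast hdist.trans_lt hlt
  linarith

end mixture

/-! ### Uniqueness and conclusion. -/

/-- Compare the common minimal energy with that of the midpoint `(μ + ν) / 2`. -/
theorem pairEnergy_add_le_of_minimizers {E : Type*} [MeasurableSpace E] [AddCommGroup E]
    [MeasurableSub₂ E] {V : E → ENNReal} (hV : Measurable V) (hneg : ∀ x, V (-x) = V x)
    {μ ν : Measure E} [IsProbabilityMeasure μ] [IsProbabilityMeasure ν]
    (hμ : ∀ ρ : Measure E, IsProbabilityMeasure ρ → pairEnergy V μ μ ≤ pairEnergy V ρ ρ)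
    (hν : ∀ ρ : Measure E, IsProbabilityMeasure ρ → pairEnergy V ν ν ≤ pairEnergy V ρ ρ)
    (hfin : pairEnergy V μ μ ≠ ⊤) :
    pairEnergy V μ μ + pairEnergy V ν ν ≤ 2 * pairEnergy V μ ν := by
  have hp : IsProbabilityMeasure ((2 : ENNReal)⁻¹ • (μ + ν)) := by
    constructor
    simp only [Measure.smul_apply, Measure.add_apply, measure_univ, smul_eq_mul]
    rw [one_add_one_eq_two, ENNReal.inv_mul_cancel (by simp) (by simp)]
  have heq : pairEnergy V μ μ = pairEnergy V ν ν :=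
    le_antisymm (hμ ν inferInstance) (hν μ inferInstance)
  have h := hμ _ hp
  rw [pairEnergy_smul_left, pairEnergy_smul_right hV, pairEnergy_add_left,
    pairEnergy_add_right hV, pairEnergy_add_right hV, pairEnergy_comm hV hneg ν μ, ← heq] at h
  rw [← heq]
  have h4 : 2 * (2 * pairEnergy V μ μ) ≤ pairEnergy V μ μ + pairEnergy V μ ν
      + (pairEnergy V μ ν + pairEnergy V μ μ) := by
    calc 2 * (2 * pairEnergy V μ μ) ≤ 2 * (2 * (2⁻¹ * (2⁻¹ * (pairEnergy V μ μ
          + pairEnergy V μ ν + (pairEnergy V μ ν + pairEnergy V μ μ))))) := by gcongr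
      _ = (2 * 2⁻¹) * (2 * 2⁻¹) * (pairEnergy V μ μ
          + pairEnergy V μ ν + (pairEnergy V μ ν + pairEnergy V μ μ)) := by ring
      _ = _ := by rw [ENNReal.mul_inv_cancel (by simp) (by simp)]; simp
  generalize pairEnergy V μ μ = I at *
  generalize pairEnergy V μ ν = J at *
  by_cases hJ : J = ⊤
  · simp [hJ]
  lift I to NNReal using hfin
  lift J to NNReal using hJ
  have h5 : 2 * (2 * (I : ℝ)) ≤ I + J + (J + I) := by exact_mod_cast h4
  have h6 : (I : ℝ) + I ≤ 2 * J := by linarith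
  exact_mod_cast h6

/-- The centre of mass is itself within `2 L` of `x₀`, so recentring doubles the radius. -/
theorem exists_centered_translate {d : ℕ} {L : ℝ} {ρ : Measure (EuclideanSpace ℝ (Fin d))}
    [IsProbabilityMeasure ρ] {x₀ : EuclideanSpace ℝ (Fin d)} (h : ∀ᵐ x ∂ρ, ‖x - x₀‖ ≤ 2 * L) :
    ∃ m : EuclideanSpace ℝ (Fin d), (∀ᵐ x ∂(ρ.map (· + m)), ‖x‖ ≤ 4 * L)
      ∧ ∫ x, x ∂(ρ.map (· + m)) = 0 := by
  have hi : Integrable (fun x => x - x₀) ρ :=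
    Integrable.mono' (integrable_const (2 * L))
      (measurable_id.sub_const x₀).aestronglyMeasurable h
  have hi' : Integrable (fun x => x) ρ := by
    refine (hi.add (integrable_const x₀)).congr (Eventually.of_forall fun x => ?_)
    simp
  have hm : Measurable fun x : EuclideanSpace ℝ (Fin d) => x + -∫ x, x ∂ρ :=
    measurable_id.add_const _
  refine ⟨-∫ x, x ∂ρ, ?_, ?_⟩
  · rw [ae_map_iff hm.aemeasurable (measurableSet_le measurable_norm measurable_const)]
    have h1 : ‖∫ x, (x - x₀) ∂ρ‖ ≤ 2 * L := by
      simpa using norm_integral_le_of_norm_le_const h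
    rw [integral_sub hi' (integrable_const _)] at h1
    simp only [integral_const, probReal_univ, one_smul] at h1
    filter_upwards [h] with x hx
    calc ‖x + -∫ x, x ∂ρ‖ = ‖(x - x₀) - ((∫ x, x ∂ρ) - x₀)‖ := by congr 1; abel
      _ ≤ 2 * L + 2 * L := (norm_sub_le _ _).trans (add_le_add hx h1)
      _ = 4 * L := by ring
  · rw [integral_map (f := fun x => x) hm.aemeasurable measurable_id.aestronglyMeasurable,
      integral_add hi' (integrable_const _)]
    simp

theorem theorem1p2 (d : ℕ) (hd : 1 ≤ d) (b : ℝ) (hbd : -(d : ℝ) < b) (hb2 : b < 2) :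
    ∃ aMinus : ℝ, aMinus < 2 ∧ ∀ a : ℝ, b < a → aMinus < a → a < 2 →
      HasUniqueMinimizerUpToTranslation (powerLawPotential d a b) := by
  -- Keeping `a` above a fixed `a₀ > max b 1` makes the radius `L`, and hence `C`, independent of
  -- `a`; only then is `a` pushed towards `2` to get `mixtureWeight a * C < 1`.
  obtain ⟨a₀, ha₀, ha₀2⟩ := exists_between (max_lt hb2 (show (1 : ℝ) < 2 by norm_num))
  have hba₀ : b < a₀ := (le_max_left _ _).trans_lt ha₀
  have h1a₀ : 1 < a₀ := (le_max_right _ _).trans_lt ha₀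
  obtain ⟨μ₀, K, hμ₀, hK⟩ := exists_pairEnergy_shiftedKernel_le hd hbd
  obtain ⟨L, hL1, hL⟩ := exists_forall_le_shiftedKernel (d := d) h1a₀.le hba₀ (4 * K + 1)
  obtain ⟨C, hC0, hC⟩ := exists_mixtureDist_le hbd hb2 (R := 4 * L) (by linarith)
  have hκ : ∀ᶠ a in 𝓝[<] (2 : ℝ), mixtureWeight a * C < 1 := by
    have := tendsto_mixtureWeight.mul_const C
    rw [zero_mul] at this
    exact this.eventually_lt_const one_pos
  obtain ⟨a₁, ha₁, hκ⟩ := mem_nhdsLT_iff_exists_Ioo_subset.1 hκ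
  refine ⟨max a₀ a₁, max_lt ha₀2 ha₁, fun a hba ha ha2 => ?_⟩
  have haa₀ : a₀ < a := (le_max_left _ _).trans_lt ha
  have hq : mixtureWeight a * C < 1 := hκ ⟨(le_max_right _ _).trans_lt ha, ha2⟩
  have ha0 : 0 < a := by linarith
  have hVc := continuous_shiftedKernel (d := d) (b := b) ha0
  have hV := hVc.measurable
  have hK' := hK a (by linarith)
  refine ⟨?_, fun ρ₀ ρ₁ h₀ h₁ => ?_⟩
  · obtain ⟨ρ, hρ⟩ := exists_minimizer_pairEnergy hVc shiftedKernel_neg (fun K' => by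
      obtain ⟨L', -, hL'⟩ := exists_forall_le_shiftedKernel (d := d) h1a₀.le hba₀ K'
      exact ⟨L', hL' a haa₀ ha2⟩) ⟨μ₀, hμ₀, ne_top_of_le_ne_top ENNReal.coe_ne_top hK'⟩
    exact ⟨ρ, (isEnergyMinimizer_powerLawPotential_iff ha0 hba ρ).2 hρ⟩
  · rw [isEnergyMinimizer_powerLawPotential_iff ha0 hba] at h₀ h₁
    obtain ⟨hp₀, hmin₀⟩ := h₀
    obtain ⟨hp₁, hmin₁⟩ := h₁
    obtain ⟨x₀, hx₀⟩ := exists_ae_norm_sub_le_of_minimizer hV (hL a haa₀ ha2) hmin₀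
      ((hmin₀ _ hμ₀).trans hK')
    obtain ⟨x₁, hx₁⟩ := exists_ae_norm_sub_le_of_minimizer hV (hL a haa₀ ha2) hmin₁
      ((hmin₁ _ hμ₀).trans hK')
    obtain ⟨m₀, hs₀, hc₀⟩ := exists_centered_translate hx₀
    obtain ⟨m₁, hs₁, hc₁⟩ := exists_centered_translate hx₁
    have hadd : ∀ m : EuclideanSpace ℝ (Fin d), Measurable fun x => x + m :=
      fun m => measurable_id.add_const m
    have hp₀' := Measure.isProbabilityMeasure_map (μ := ρ₀) (hadd m₀).aemeasurable
    have hp₁' := Measure.isProbabilityMeasure_map (μ := ρ₁) (hadd m₁).aemeasurable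
    have he₀ := pairEnergy_map_add hV m₀ ρ₀ ρ₀
    have he₁ := pairEnergy_map_add hV m₁ ρ₁ ρ₁
    rw [← he₀] at hmin₀
    rw [← he₁] at hmin₁
    have hf₀ := ne_top_of_le_ne_top ENNReal.coe_ne_top ((hmin₀ _ hμ₀).trans hK')
    have hf₁ := ne_top_of_le_ne_top ENNReal.coe_ne_top ((hmin₁ _ hμ₀).trans hK')
    have heq := eq_of_pairEnergy_add_le hbd ha0 ha2 hba (by linarith) hs₀ hs₁ hc₀ hc₁ hq
      (hC _ _ hs₀ hs₁ hc₀ hc₁ a hba ha2) hf₀ hf₁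
      (pairEnergy_add_le_of_minimizers hV shiftedKernel_neg hmin₀ hmin₁ hf₀)
    refine ⟨m₀ - m₁, ?_⟩
    have h1 : ρ₁ = (ρ₁.map (· + m₁)).map (· + -m₁) := by
      rw [Measure.map_map (hadd _) (hadd _)]
      simp [Function.comp_def]
    rw [h1, ← heq, Measure.map_map (hadd _) (hadd _)]
    congr 1
    funext x
    simp only [Function.comp_apply]
    abel
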